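/- **Conventions.** $\mathcal C$ is a bicategory; $g*f$ is composition of arrows and whiskering, $\circ$ is vertical composition of 2-cells, and associators and unitors are suppressed. All limits and colimits are bicategorical (the universal property is an equivalence of categories). A pair $(i,p)$, $i:A\to X$, $p:Y\to B$, has the *lifting property* if (1) each invertible $\gamma: p*a\Rightarrow b*i$ has a filler, i.e. an arrow $f:X\to Y$ and invertible 2-cells $\lambda:a\Rightarrow f*i$, $\rho:p*f\Rightarrow b$ with $(\rho*i)\circ(p*\lambda)=\gamma$, and (2) for fillers $(f_k,\lambda_k,\rho_k)$ of $\gamma_k:p*a_k\Rightarrow b_k*i$ ($k=1,2$) and 2-cells $\alpha:a_1\Rightarrow a_2$, $\beta:b_1\Rightarrow b_2$ with $\gamma_2\circ(p*\alpha)=(\beta*i)\circ\gamma_1$ there is $\delta:f_1\Rightarrow f_2$ with $\lambda_2\circ\alpha=(\delta*i)\circ\lambda_1$ and $\rho_2\circ(p*\delta)=\beta\circ\rho_1$. A *model bicategory* is a bicategory $\mathcal C$ with classes of arrows called fibrations, cofibrations and weak equivalences ($\mathcal W$) such that: $\mathcal C$ has initial and terminal objects, pullbacks and pushouts; a cofibration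 and a fibration, one of which is in $\mathcal W$, have the lifting property; every arrow is isomorphic to a cofibration followed by a fibration, and either of the two can be required to be in $\mathcal W$; fibrations (cofibrations) are closed under composition, pullbacks (pushouts) and invertible 2-cells and contain the equivalences; pullbacks (pushouts) of fibrations (cofibrations) in $\mathcal W$ are in $\mathcal W$; $\mathcal W$ contains the equivalences, and if $g*f\cong h$ and two of $f,g,h$ are in $\mathcal W$, so is the third. An object $X$ is fibrant if $X\to *$ is a fibration, cofibrant if $0\to X$ is a cofibration. A *$\sigma$-homotopy* $H$ from $f$ to $g$ ($f,g:X\to Y$) consists of arrows $d_0,d_1:X\to W$, $x:X\to Z$, $s:W\to Z$ in $\mathcal W$, invertible 2-cells $\alpha_k:s*d_k\Rightarrow x$, an arrow $h:W\to Y$ and 2-cells $\eta:f\Rightarrow h*d_0$, $\varepsilon:h*d_1\Rightarrow g$. It is a *$w$-homotopy* if $Z=X$, $x=\mathrm{id}_X$ and the induced arrow $X\amalg X\to W$ is a cofibration; it *has invertible cells* if $\eta,\varepsilon$ are invertible. A *quasiequivalence* is an arrow such that composing with it on either side is full and faithful on hom-categories. If a 2-functor $F:\mathcal C\to\mathcal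 D$ maps $\mathcal W$ to quasiequivalences, then $\widehat{FH}=F\varepsilon\circ(Fh*c)\circ F\eta$, where $c:Fd_0\Rightarrow Fd_1$ is the unique 2-cell with $Fs*c=F(\alpha_1^{-1}\circ\alpha_0)$; for a finite composable sequence of $\sigma$-homotopies one composes these 2-cells. Two sequences are in the same class if they give the same 2-cell for every such $F$. The bicategory $\mathcal Ho(\mathcal C,\mathcal W)$ has the objects and arrows of $\mathcal C$, and as 2-cells the classes $[H]$ of finite composable sequences of $\sigma$-homotopies, composed vertically by juxtaposition and whiskered with arrows in the evident way. The projection 2-functor $i:\mathcal C\to\mathcal Ho(\mathcal C,\mathcal W)$ is the identity on objects and arrows and sends a 2-cell $\mu$ to the class of a $\sigma$-homotopy $I^\mu$ with $\widehat{FI^\mu}=F\mu$ for all $F$. Finally $\mathcal Ho(\mathcal C)=\mathcal Ho_{fc}(\mathcal C,\mathcal W)$ is the full sub-bicategory on the objects that are fibrant and cofibrant. A *cofibrant replacement* $Q$ consists of: for each object $X$ a cofibrant $QX$ and a fibration $p_X:QX\to X$ in $\mathcal W$; for each $f:X\to Y$ an arrow $Qf:QX\to QY$ and an invertible 2-cell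 $\rho_f:p_Y*Qf\Rightarrow f*p_X$; for each $\mu:f\Rightarrow g$ a 2-cell $Q\mu:Qf\Rightarrow Qg$ with $p_Y*Q\mu=\rho_g^{-1}\circ(\mu*p_X)\circ\rho_f$. It is *normalized* if $QX=X$, $p_X=\mathrm{id}$, $Qf=f$, $\rho_f=\mathrm{id}_f$, $Q\mu=\mu$ whenever the objects involved are cofibrant. Dually, a (normalized) *fibrant replacement* $R$ has cofibrations $i_X:X\to RX$ in $\mathcal W$ with $RX$ fibrant, arrows $Rf$, invertible 2-cells $\lambda_f:i_Y*f\Rightarrow Rf*i_X$, and 2-cells $R\mu$ with $R\mu*i_X=\lambda_g\circ(i_Y*\mu)\circ\lambda_f^{-1}$. **Proposition.** Let $\mathcal C$ be a model bicategory. Normalized cofibrant and fibrant replacements of $\mathcal C$ exist. For all cofibrant replacements $Q$ and fibrant replacements $R$ there is a pseudofunctor $r:\mathcal C\to\mathcal Ho(\mathcal C)$ given on objects, arrows and 2-cells by $$X\mapsto RQX,\qquad f\mapsto RQf,\qquad \mu\mapsto i(RQ\mu).$$ Its structural 2-cells $\xi_X:\mathrm{id}_{RQX}\Rightarrow RQ(\mathrm{id}_X)$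 and $\phi_{f,g}:RQg*RQf\Rightarrow RQ(g*f)$ are classes of $w$-homotopies with invertible cells built by the replacement: for each $X$ there are $w$-homotopies with invertible cells, $H$ from $\mathrm{id}_{QX}$ to $Q(\mathrm{id}_X)$ and $K$ from $\mathrm{id}_{RQX}$ to $RQ(\mathrm{id}_X)$, such that $\xi_X=[K]$ and, in $\mathcal Ho(\mathcal C,\mathcal W)$, $$p_X*[H]=i(\rho_{\mathrm{id}_X}^{-1}),\qquad [K]*i_{QX}=i(\lambda_{Q(\mathrm{id}_X)})\circ(i_{QX}*[H]);$$ and for all $f:X\to Y$, $g:Y\to Z$ there are $w$-homotopies with invertible cells, $H$ from $Qg*Qf$ to $Q(g*f)$ and $K$ from $RQg*RQf$ to $RQ(g*f)$, such that $\phi_{f,g}=[K]$ and, in $\mathcal Ho(\mathcal C,\mathcal W)$, $$p_Z*[H]=i\big(\rho_{g*f}^{-1}\circ(g*\rho_f)\circ(\rho_g*Qf)\big),$$ $$[K]*i_{QX}=i(\lambda_{Q(g*f)})\circ(i_{QZ}*[H])\circ i\big((\lambda_{Qg}^{-1}*Qf)\circ(RQg*\lambda_{Qf}^{-1})\big).$$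 -/

import Mathlib

open CategoryTheory Bicategory

universe w₁ v₁ u₁ w v u

set_option linter.checkUnivs false

namespace ModelBicat

section Basics

variable {C : Type u} [Bicategory.{w, v} C]

/-- An arrow is an equivalence if it has a quasi-inverse up to invertible 2-cells. -/
def IsEquivalence {X Y : C} (f : X ⟶ Y) : Prop :=
  ∃ g : Y ⟶ X, Nonempty (f ≫ g ≅ 𝟙 X) ∧ Nonempty (g ≫ f ≅ 𝟙 Y)

/-- An arrow `f : X ⟶ Y` is a quasiequivalence if, for every object `Z`, postcomposition
`C(Z, X) ⥤ C(Z, Y)` and precomposition `C(Y, Z) ⥤ C(X, Z)` with `f` are full and faithful. -/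
structure IsQuasiequivalence {X Y : C} (f : X ⟶ Y) : Prop where
  full_postcomp : ∀ Z : C, (postcomp Z f).Full
  faithful_postcomp : ∀ Z : C, (postcomp Z f).Faithful
  full_precomp : ∀ Z : C, (precomp Z f).Full
  faithful_precomp : ∀ Z : C, (precomp Z f).Faithful

/-- A filler of a square `γ : a ≫ p ≅ i ≫ b`. -/
structure Filler {A X Y B : C} {i : A ⟶ X} {p : Y ⟶ B} {a : A ⟶ Y} {b : X ⟶ B}
    (γ : a ≫ p ≅ i ≫ b) where
  f : X ⟶ Y
  lam : a ≅ i ≫ f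
  rho : f ≫ p ≅ b
  fac : lam.hom ▷ p ≫ (α_ i f p).hom ≫ i ◁ rho.hom = γ.hom

/-- The (two-dimensional) lifting property of a pair of arrows. -/
structure HasLifting {A X Y B : C} (i : A ⟶ X) (p : Y ⟶ B) : Prop where
  lift : ∀ {a : A ⟶ Y} {b : X ⟶ B} (γ : a ≫ p ≅ i ≫ b), Nonempty (Filler γ)
  lift₂ : ∀ {a₁ a₂ : A ⟶ Y} {b₁ b₂ : X ⟶ B} (γ₁ : a₁ ≫ p ≅ i ≫ b₁) (γ₂ : a₂ ≫ p ≅ i ≫ b₂)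
    (φ₁ : Filler γ₁) (φ₂ : Filler γ₂) (α : a₁ ⟶ a₂) (β : b₁ ⟶ b₂),
    α ▷ p ≫ γ₂.hom = γ₁.hom ≫ i ◁ β →
    ∃ δ : φ₁.f ⟶ φ₂.f, α ≫ φ₂.lam.hom = φ₁.lam.hom ≫ i ◁ δ ∧
      δ ▷ p ≫ φ₂.rho.hom = φ₁.rho.hom ≫ β

/-! Bicategorical limits and colimits: the comparison functors from hom-categories to categories
of (pseudo)cones are equivalences, i.e. essentially surjective and fully faithful. -/

/-- `I` is a bicategorical initial object: each `C(I, X)` is equivalent to the point. -/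
structure IsBiinitial (I : C) : Prop where
  exists_hom : ∀ X : C, Nonempty (I ⟶ X)
  unique₂ : ∀ {X : C} (f g : I ⟶ X), Nonempty (Unique (f ⟶ g))

/-- `T` is a bicategorical terminal object. -/
structure IsBiterminal (T : C) : Prop where
  exists_hom : ∀ X : C, Nonempty (X ⟶ T)
  unique₂ : ∀ {X : C} (f g : X ⟶ T), Nonempty (Unique (f ⟶ g))

/-- The square `γ : p ≫ f ≅ q ≫ g` is a bicategorical pullback. -/
structure IsBipullback {P A B D : C} {f : A ⟶ D} {g : B ⟶ D} {p : P ⟶ A} {q : P ⟶ B}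
    (γ : p ≫ f ≅ q ≫ g) : Prop where
  lift : ∀ {Z : C} (a : Z ⟶ A) (b : Z ⟶ B) (δ : a ≫ f ≅ b ≫ g),
    ∃ (k : Z ⟶ P) (σ : k ≫ p ≅ a) (τ : k ≫ q ≅ b),
      σ.hom ▷ f ≫ δ.hom = (α_ k p f).hom ≫ k ◁ γ.hom ≫ (α_ k q g).inv ≫ τ.hom ▷ g
  lift₂ : ∀ {Z : C} (k l : Z ⟶ P) (σ : k ≫ p ⟶ l ≫ p) (τ : k ≫ q ⟶ l ≫ q),
    σ ▷ f ≫ (α_ l p f).hom ≫ l ◁ γ.hom ≫ (α_ l q g).inv =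
      (α_ k p f).hom ≫ k ◁ γ.hom ≫ (α_ k q g).inv ≫ τ ▷ g →
    ∃! θ : k ⟶ l, θ ▷ p = σ ∧ θ ▷ q = τ

/-- The square `γ : f ≫ p ≅ g ≫ q` is a bicategorical pushout. -/
structure IsBipushout {P A B D : C} {f : D ⟶ A} {g : D ⟶ B} {p : A ⟶ P} {q : B ⟶ P}
    (γ : f ≫ p ≅ g ≫ q) : Prop where
  desc : ∀ {Z : C} (a : A ⟶ Z) (b : B ⟶ Z) (δ : f ≫ a ≅ g ≫ b),
    ∃ (k : P ⟶ Z) (σ : p ≫ k ≅ a) (τ : q ≫ k ≅ b),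
      f ◁ σ.hom ≫ δ.hom = (α_ f p k).inv ≫ γ.hom ▷ k ≫ (α_ g q k).hom ≫ g ◁ τ.hom
  desc₂ : ∀ {Z : C} (k l : P ⟶ Z) (σ : p ≫ k ⟶ p ≫ l) (τ : q ≫ k ⟶ q ≫ l),
    f ◁ σ ≫ (α_ f p l).inv ≫ γ.hom ▷ l ≫ (α_ g q l).hom =
      (α_ f p k).inv ≫ γ.hom ▷ k ≫ (α_ g q k).hom ≫ g ◁ τ →
    ∃! θ : k ⟶ l, p ◁ θ = σ ∧ q ◁ θ = τ

/-- `i₀ : X ⟶ S`, `i₁ : Y ⟶ S` exhibit `S` as a bicategorical coproduct of `X` and `Y`. -/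
structure IsBicoproduct {X Y S : C} (i₀ : X ⟶ S) (i₁ : Y ⟶ S) : Prop where
  desc : ∀ {Z : C} (f : X ⟶ Z) (g : Y ⟶ Z),
    ∃ k : S ⟶ Z, Nonempty (i₀ ≫ k ≅ f) ∧ Nonempty (i₁ ≫ k ≅ g)
  desc₂ : ∀ {Z : C} (k l : S ⟶ Z) (σ : i₀ ≫ k ⟶ i₀ ≫ l) (τ : i₁ ≫ k ⟶ i₁ ≫ l),
    ∃! θ : k ⟶ l, i₀ ◁ θ = σ ∧ i₁ ◁ θ = τ

theorem isEquivalence_id (X : C) : IsEquivalence (𝟙 X) :=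
  ⟨𝟙 X, ⟨λ_ _⟩, ⟨λ_ _⟩⟩

end Basics

/-- Model bicategory structures. -/
class ModelBicategory (C : Type u) [Bicategory.{w, v} C] where
  /-- fibrations -/
  fib : MorphismProperty C
  /-- cofibrations -/
  cof : MorphismProperty C
  /-- weak equivalences -/
  weq : MorphismProperty C
  exists_initial : ∃ I : C, IsBiinitial I
  exists_terminal : ∃ T : C, IsBiterminal T
  exists_pullback : ∀ {A B D : C} (f : A ⟶ D) (g : B ⟶ D),
    ∃ (P : C) (p : P ⟶ A) (q : P ⟶ B) (γ : p ≫ f ≅ q ≫ g), IsBipullback γ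
  exists_pushout : ∀ {A B D : C} (f : D ⟶ A) (g : D ⟶ B),
    ∃ (P : C) (p : A ⟶ P) (q : B ⟶ P) (γ : f ≫ p ≅ g ≫ q), IsBipushout γ
  lifting : ∀ {A X Y B : C} (i : A ⟶ X) (p : Y ⟶ B), cof i → fib p → (weq i ∨ weq p) →
    HasLifting i p
  factor_left : ∀ {X Y : C} (f : X ⟶ Y), ∃ (Z : C) (i : X ⟶ Z) (p : Z ⟶ Y),
    cof i ∧ weq i ∧ fib p ∧ Nonempty (f ≅ i ≫ p)
  factor_right : ∀ {X Y : C} (f : X ⟶ Y), ∃ (Z : C) (i : X ⟶ Z) (p : Z ⟶ Y),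
    cof i ∧ fib p ∧ weq p ∧ Nonempty (f ≅ i ≫ p)
  fib_comp : ∀ {X Y Z : C} (f : X ⟶ Y) (g : Y ⟶ Z), fib f → fib g → fib (f ≫ g)
  cof_comp : ∀ {X Y Z : C} (f : X ⟶ Y) (g : Y ⟶ Z), cof f → cof g → cof (f ≫ g)
  fib_pullback : ∀ {P A B D : C} {f : A ⟶ D} {g : B ⟶ D} {p : P ⟶ A} {q : P ⟶ B}
    (γ : p ≫ f ≅ q ≫ g), IsBipullback γ → fib f → fib q
  cof_pushout : ∀ {P A B D : C} {f : D ⟶ A} {g : D ⟶ B} {p : A ⟶ P} {q : B ⟶ P}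
    (γ : f ≫ p ≅ g ≫ q), IsBipushout γ → cof f → cof q
  fib_of_equivalence : ∀ {X Y : C} (f : X ⟶ Y), IsEquivalence f → fib f
  cof_of_equivalence : ∀ {X Y : C} (f : X ⟶ Y), IsEquivalence f → cof f
  fib_of_iso : ∀ {X Y : C} {f g : X ⟶ Y}, (f ≅ g) → fib f → fib g
  cof_of_iso : ∀ {X Y : C} {f g : X ⟶ Y}, (f ≅ g) → cof f → cof g
  weq_pullback : ∀ {P A B D : C} {f : A ⟶ D} {g : B ⟶ D} {p : P ⟶ A} {q : P ⟶ B}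
    (γ : p ≫ f ≅ q ≫ g), IsBipullback γ → fib f → weq f → weq q
  weq_pushout : ∀ {P A B D : C} {f : D ⟶ A} {g : D ⟶ B} {p : A ⟶ P} {q : B ⟶ P}
    (γ : f ≫ p ≅ g ≫ q), IsBipushout γ → cof f → weq f → weq q
  weq_comp : ∀ {X Y Z : C} {f : X ⟶ Y} {g : Y ⟶ Z} {h : X ⟶ Z}, (f ≫ g ≅ h) →
    weq f → weq g → weq h
  weq_right : ∀ {X Y Z : C} {f : X ⟶ Y} {g : Y ⟶ Z} {h : X ⟶ Z}, (f ≫ g ≅ h) →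
    weq f → weq h → weq g
  weq_left : ∀ {X Y Z : C} {f : X ⟶ Y} {g : Y ⟶ Z} {h : X ⟶ Z}, (f ≫ g ≅ h) →
    weq g → weq h → weq f
  weq_of_equivalence : ∀ {X Y : C} (f : X ⟶ Y), IsEquivalence f → weq f

open ModelBicategory

section Objects

variable {C : Type u} [Bicategory.{w, v} C] [ModelBicategory C]

/-- `X` is fibrant if the arrow `X ⟶ *` is a fibration. -/
def IsFibrant (X : C) : Prop :=
  ∃ T : C, IsBiterminal T ∧ ∃ t : X ⟶ T, fib t

/-- `X` is cofibrant if the arrow `0 ⟶ X` is a cofibration. -/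
def IsCofibrant (X : C) : Prop :=
  ∃ I : C, IsBiinitial I ∧ ∃ t : I ⟶ X, cof t

theorem weq_id (X : C) : weq (𝟙 X) := weq_of_equivalence _ (isEquivalence_id X)

theorem IsCofibrant.of_cof {X Y : C} (hX : IsCofibrant X) (f : X ⟶ Y) (hf : cof f) :
    IsCofibrant Y := by
  obtain ⟨I, hI, t, ht⟩ := hX
  exact ⟨I, hI, t ≫ f, cof_comp _ _ ht hf⟩

end Objects

section Homotopies

variable {C : Type u} [Bicategory.{w, v} C] [ModelBicategory C]

/-- A σ-cylinder for `X`. -/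
structure SigmaCylinder (X : C) where
  W : C
  Z : C
  d₀ : X ⟶ W
  d₁ : X ⟶ W
  x : X ⟶ Z
  s : W ⟶ Z
  weq_s : weq s
  α₀ : d₀ ≫ s ≅ x
  α₁ : d₁ ≫ s ≅ x

/-- A (left) σ-homotopy from `f` to `g`. -/
structure SigmaHomotopy {X Y : C} (f g : X ⟶ Y) where
  cyl : SigmaCylinder X
  h : cyl.W ⟶ Y
  eta : f ⟶ cyl.d₀ ≫ h
  eps : cyl.d₁ ≫ h ⟶ g

/-- A w-cylinder for `X`: a σ-cylinder with `Z = X`, `x = 𝟙 X` such that the arrow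
`X ⨿ X ⟶ W` induced by `d₀` and `d₁` is a cofibration. -/
structure WCylinder (X : C) where
  W : C
  d₀ : X ⟶ W
  d₁ : X ⟶ W
  s : W ⟶ X
  weq_s : weq s
  α₀ : d₀ ≫ s ≅ 𝟙 X
  α₁ : d₁ ≫ s ≅ 𝟙 X
  cof_d : ∃ (S : C) (i₀ i₁ : X ⟶ S) (d : S ⟶ W), IsBicoproduct i₀ i₁ ∧
    Nonempty (i₀ ≫ d ≅ d₀) ∧ Nonempty (i₁ ≫ d ≅ d₁) ∧ cof d

/-- The σ-cylinder underlying a w-cylinder. -/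
@[simps] def WCylinder.toSigma {X : C} (c : WCylinder X) : SigmaCylinder X where
  W := c.W
  Z := X
  d₀ := c.d₀
  d₁ := c.d₁
  x := 𝟙 X
  s := c.s
  weq_s := c.weq_s
  α₀ := c.α₀
  α₁ := c.α₁

/-- A (left) w-homotopy from `f` to `g`. -/
structure WHomotopy {X Y : C} (f g : X ⟶ Y) where
  cyl : WCylinder X
  h : cyl.W ⟶ Y
  eta : f ⟶ cyl.d₀ ≫ h
  eps : cyl.d₁ ≫ h ⟶ g

/-- The σ-homotopy underlying a w-homotopy. -/
@[simps] def WHomotopy.toSigma {X Y : C} {f g : X ⟶ Y} (H : WHomotopy f g) :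
    SigmaHomotopy f g where
  cyl := H.cyl.toSigma
  h := H.h
  eta := H.eta
  eps := H.eps

/-- A w-homotopy has invertible cells if `eta` and `eps` are invertible. -/
def WHomotopy.HasInvertibleCells {X Y : C} {f g : X ⟶ Y} (H : WHomotopy f g) : Prop :=
  IsIso H.eta ∧ IsIso H.eps

/-- The composite of an arrow `l : X' ⟶ X` and a σ-cylinder. -/
@[simps] def SigmaCylinder.whiskerLeft {X' X : C} (l : X' ⟶ X) (c : SigmaCylinder X) :
    SigmaCylinder X' where
  W := c.W
  Z := c.Z
  d₀ := l ≫ c.d₀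
  d₁ := l ≫ c.d₁
  x := l ≫ c.x
  s := c.s
  weq_s := c.weq_s
  α₀ := α_ _ _ _ ≪≫ whiskerLeftIso l c.α₀
  α₁ := α_ _ _ _ ≪≫ whiskerLeftIso l c.α₁

/-- The composite of an arrow `l : X' ⟶ X` and a σ-homotopy. -/
@[simps] def SigmaHomotopy.whiskerLeft {X' X Y : C} (l : X' ⟶ X) {f g : X ⟶ Y}
    (H : SigmaHomotopy f g) : SigmaHomotopy (l ≫ f) (l ≫ g) where
  cyl := H.cyl.whiskerLeft l
  h := H.h
  eta := l ◁ H.eta ≫ (α_ l H.cyl.d₀ H.h).inv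
  eps := (α_ l H.cyl.d₁ H.h).hom ≫ l ◁ H.eps

/-- The composite of a σ-homotopy and an arrow `r : Y ⟶ Y'`. -/
@[simps] def SigmaHomotopy.whiskerRight {X Y Y' : C} {f g : X ⟶ Y}
    (H : SigmaHomotopy f g) (r : Y ⟶ Y') : SigmaHomotopy (f ≫ r) (g ≫ r) where
  cyl := H.cyl
  h := H.h ≫ r
  eta := H.eta ▷ r ≫ (α_ _ _ _).hom
  eps := (α_ _ _ _).inv ≫ H.eps ▷ r

/-- The constant σ-cylinder for `X`. -/
@[simps] def SigmaCylinder.refl (X : C) : SigmaCylinder X where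
  W := X
  Z := X
  d₀ := 𝟙 X
  d₁ := 𝟙 X
  x := 𝟙 X
  s := 𝟙 X
  weq_s := weq_id X
  α₀ := λ_ (𝟙 X)
  α₁ := λ_ (𝟙 X)

/-- The σ-homotopy `I^μ` associated with a 2-cell `μ`. -/
@[simps] def SigmaHomotopy.ofCell {X Y : C} {f g : X ⟶ Y} (μ : f ⟶ g) : SigmaHomotopy f g where
  cyl := SigmaCylinder.refl X
  h := f
  eta := (λ_ f).inv
  eps := (λ_ f).hom ≫ μ

/-- Finite composable sequences of σ-homotopies. -/
inductive HtpySeq {X Y : C} : (X ⟶ Y) → (X ⟶ Y) → Type (max u v w)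
  | nil (f : X ⟶ Y) : HtpySeq f f
  | cons {f g h : X ⟶ Y} (H : SigmaHomotopy f g) (s : HtpySeq g h) : HtpySeq f h

namespace HtpySeq

/-- Juxtaposition. -/
def append {X Y : C} {f g h : X ⟶ Y} : HtpySeq f g → HtpySeq g h → HtpySeq f h
  | nil _, t => t
  | cons H s, t => cons H (append s t)

def single {X Y : C} {f g : X ⟶ Y} (H : SigmaHomotopy f g) : HtpySeq f g := cons H (nil g)

def whiskerLeft {X' X Y : C} (l : X' ⟶ X) {f g : X ⟶ Y} :
    HtpySeq f g → HtpySeq (l ≫ f) (l ≫ g)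
  | nil _ => nil _
  | cons H s => cons (H.whiskerLeft l) (whiskerLeft l s)

def whiskerRight {X Y Y' : C} {f g : X ⟶ Y} (s : HtpySeq f g) (r : Y ⟶ Y') :
    HtpySeq (f ≫ r) (g ≫ r) :=
  match s with
  | nil _ => nil _
  | cons H s => cons (H.whiskerRight r) (whiskerRight s r)

end HtpySeq

end Homotopies

section Aux

variable {C : Type u} [Bicategory.{w, v} C] {D : Type u₁} [Bicategory.{w₁, v₁} D] (F : C ⥤ᵖ D)

variable {X Y Z T : C}

theorem aux_assoc_inv (f : X ⟶ Y) (g : Y ⟶ Z) (h : Z ⟶ T) :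
    F.map₂ (α_ f g h).inv = (F.mapComp f (g ≫ h)).hom ≫ F.map f ◁ (F.mapComp g h).hom ≫
      (α_ _ _ _).inv ≫ (F.mapComp f g).inv ▷ F.map h ≫ (F.mapComp (f ≫ g) h).inv := by
  rw [← cancel_epi (F.map₂ (α_ f g h).hom), ← F.map₂_comp]
  simp [-PrelaxFunctor.map₂_comp]

theorem aux_lu_inv (f : X ⟶ Y) :
    F.map₂ (λ_ f).inv = (λ_ (F.map f)).inv ≫ (F.mapId X).inv ▷ F.map f ≫
      (F.mapComp (𝟙 X) f).inv := by
  rw [← cancel_epi (F.map₂ (λ_ f).hom), ← F.map₂_comp]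
  simp [-PrelaxFunctor.map₂_comp]

theorem aux_ru_inv (f : X ⟶ Y) :
    F.map₂ (ρ_ f).inv = (ρ_ (F.map f)).inv ≫ F.map f ◁ (F.mapId Y).inv ≫
      (F.mapComp f (𝟙 Y)).inv := by
  rw [← cancel_epi (F.map₂ (ρ_ f).hom), ← F.map₂_comp]
  simp [-PrelaxFunctor.map₂_comp]

theorem aux_id_whiskerLeft {f g : X ⟶ Y} (κ : F.map f ⟶ F.map g) :
    (F.mapComp (𝟙 X) f).hom ≫ F.map (𝟙 X) ◁ κ ≫ (F.mapComp (𝟙 X) g).inv =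
      F.map₂ (λ_ f).hom ≫ κ ≫ F.map₂ (λ_ g).inv := by
  have h := whisker_exchange_assoc (F.mapId X).hom κ ((F.mapId X).inv ▷ F.map g)
  rw [hom_inv_whiskerRight, Category.comp_id] at h
  simp [aux_lu_inv, h]

theorem aux_whiskerRight_id {f g : X ⟶ Y} (κ : F.map f ⟶ F.map g) :
    (F.mapComp f (𝟙 Y)).hom ≫ κ ▷ F.map (𝟙 Y) ≫ (F.mapComp g (𝟙 Y)).inv =
      F.map₂ (ρ_ f).hom ≫ κ ≫ F.map₂ (ρ_ g).inv := by
  have h := whisker_exchange_assoc κ (F.mapId Y).hom (F.map g ◁ (F.mapId Y).inv)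
  rw [← Bicategory.whiskerLeft_comp, Iso.hom_inv_id, Bicategory.whiskerLeft_id,
    Category.comp_id] at h
  simp [aux_ru_inv, ← h]

theorem aux_comp_whiskerLeft (f : X ⟶ Y) (g : Y ⟶ Z) {h h' : Z ⟶ T} (κ : F.map h ⟶ F.map h') :
    (F.mapComp (f ≫ g) h).hom ≫ F.map (f ≫ g) ◁ κ ≫ (F.mapComp (f ≫ g) h').inv =
      F.map₂ (α_ f g h).hom ≫ ((F.mapComp f (g ≫ h)).hom ≫ F.map f ◁
        ((F.mapComp g h).hom ≫ F.map g ◁ κ ≫ (F.mapComp g h').inv) ≫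
          (F.mapComp f (g ≫ h')).inv) ≫ F.map₂ (α_ f g h').inv := by
  have e := whisker_exchange_assoc (F.mapComp f g).hom κ ((F.mapComp f g).inv ▷ F.map h')
  rw [hom_inv_whiskerRight, Category.comp_id] at e
  simp at e
  simp [aux_assoc_inv, e]

theorem aux_whiskerRight_comp {f f' : X ⟶ Y} (κ : F.map f ⟶ F.map f') (g : Y ⟶ Z) (h : Z ⟶ T) :
    (F.mapComp f (g ≫ h)).hom ≫ κ ▷ F.map (g ≫ h) ≫ (F.mapComp f' (g ≫ h)).inv =
      F.map₂ (α_ f g h).inv ≫ ((F.mapComp (f ≫ g) h).hom ≫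
        ((F.mapComp f g).hom ≫ κ ▷ F.map g ≫ (F.mapComp f' g).inv) ▷ F.map h ≫
          (F.mapComp (f' ≫ g) h).inv) ≫ F.map₂ (α_ f' g h).hom := by
  have e := whisker_exchange_assoc κ (F.mapComp g h).hom (F.map f' ◁ (F.mapComp g h).inv)
  rw [← Bicategory.whiskerLeft_comp, Iso.hom_inv_id, Bicategory.whiskerLeft_id,
    Category.comp_id] at e
  simp at e
  simp [aux_assoc_inv, ← e]

theorem aux_whisker_assoc (f : X ⟶ Y) {g g' : Y ⟶ Z} (κ : F.map g ⟶ F.map g') (h : Z ⟶ T) :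
    (F.mapComp (f ≫ g) h).hom ≫ ((F.mapComp f g).hom ≫ F.map f ◁ κ ≫ (F.mapComp f g').inv) ▷
        F.map h ≫ (F.mapComp (f ≫ g') h).inv =
      F.map₂ (α_ f g h).hom ≫ ((F.mapComp f (g ≫ h)).hom ≫ F.map f ◁
        ((F.mapComp g h).hom ≫ κ ▷ F.map h ≫ (F.mapComp g' h).inv) ≫
          (F.mapComp f (g' ≫ h)).inv) ≫ F.map₂ (α_ f g' h).inv := by
  simp [aux_assoc_inv]

theorem aux_whisker_exchange {f g : X ⟶ Y} {h i : Y ⟶ Z} (κ : F.map f ⟶ F.map g)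
    (θ : F.map h ⟶ F.map i) :
    ((F.mapComp f h).hom ≫ F.map f ◁ θ ≫ (F.mapComp f i).inv) ≫
      ((F.mapComp f i).hom ≫ κ ▷ F.map i ≫ (F.mapComp g i).inv) =
    ((F.mapComp f h).hom ≫ κ ▷ F.map h ≫ (F.mapComp g h).inv) ≫
      ((F.mapComp g h).hom ≫ F.map g ◁ θ ≫ (F.mapComp g i).inv) := by
  simp [whisker_exchange_assoc]

theorem aux_refl (Y : C) : 𝟙 (F.map (𝟙 Y)) ▷ F.map (𝟙 Y) = (F.mapComp (𝟙 Y) (𝟙 Y)).inv ≫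
     F.map₂ ((λ_ (𝟙 Y)).hom ≫ (λ_ (𝟙 Y)).inv) ≫ (F.mapComp (𝟙 Y) (𝟙 Y)).hom := by
  rw [Iso.hom_inv_id, F.map₂_id]; simp

theorem aux_hat_refl {X Y : C} {f g : X ⟶ Y} (μ : f ⟶ g) :
    F.map₂ (λ_ f).inv ≫ (F.mapComp (𝟙 X) f).hom ≫ 𝟙 (F.map (𝟙 X)) ▷ F.map f ≫
      (F.mapComp (𝟙 X) f).inv ≫ F.map₂ ((λ_ f).hom ≫ μ) = F.map₂ μ := by
  rw [id_whiskerRight, Category.id_comp, Iso.hom_inv_id_assoc, ← F.map₂_comp,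
    Iso.inv_hom_id_assoc]

theorem aux_left {X' X W Z : C} (l : X' ⟶ X) {d₀ d₁ : X ⟶ W} {s : W ⟶ Z} {x : X ⟶ Z}
    (α₀ : d₀ ≫ s ≅ x) (α₁ : d₁ ≫ s ≅ x) (κ : F.map d₀ ⟶ F.map d₁)
    (h : κ ▷ F.map s = (F.mapComp d₀ s).inv ≫ F.map₂ (α₀.hom ≫ α₁.inv) ≫ (F.mapComp d₁ s).hom) :
    ((F.mapComp l d₀).hom ≫ F.map l ◁ κ ≫ (F.mapComp l d₁).inv) ▷ F.map s =
    (F.mapComp (l ≫ d₀) s).inv ≫ F.map₂ ((α_ l d₀ s ≪≫ whiskerLeftIso l α₀).hom ≫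
      (α_ l d₁ s ≪≫ whiskerLeftIso l α₁).inv) ≫ (F.mapComp (l ≫ d₁) s).hom := by
  have e : (α_ l d₀ s ≪≫ whiskerLeftIso l α₀).hom ≫ (α_ l d₁ s ≪≫ whiskerLeftIso l α₁).inv =
    (α_ l d₀ s).hom ≫ l ◁ (α₀.hom ≫ α₁.inv) ≫ (α_ l d₁ s).inv := by simp
  rw [e, F.map₂_comp, F.map₂_comp, aux_assoc_inv, F.map₂_whisker_left, F.map₂_associator]
  have := congrArg (F.map l ◁ ·) h
  simp only [Bicategory.whiskerLeft_comp] at this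
  simp only [Category.assoc, Iso.inv_hom_id_assoc, Iso.inv_hom_id,
    Category.comp_id, comp_whiskerRight, whisker_assoc]
  rw [this]
  simp

theorem aux_hat_left {X' X W Y : C} (l : X' ⟶ X) {d₀ d₁ : X ⟶ W} {f g : X ⟶ Y} (h : W ⟶ Y)
  (eta : f ⟶ d₀ ≫ h) (eps : d₁ ≫ h ⟶ g) (κ : F.map d₀ ⟶ F.map d₁) :
  F.map₂ (l ◁ eta ≫ (α_ l d₀ h).inv) ≫ (F.mapComp (l ≫ d₀) h).hom ≫
    ((F.mapComp l d₀).hom ≫ F.map l ◁ κ ≫ (F.mapComp l d₁).inv) ▷ F.map h ≫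
    (F.mapComp (l ≫ d₁) h).inv ≫ F.map₂ ((α_ l d₁ h).hom ≫ l ◁ eps) =
  (F.mapComp l f).hom ≫ F.map l ◁ (F.map₂ eta ≫ (F.mapComp d₀ h).hom ≫ κ ▷ F.map h ≫
    (F.mapComp d₁ h).inv ≫ F.map₂ eps) ≫ (F.mapComp l g).inv := by
  simp [aux_assoc_inv]

theorem aux_hat_right {X W Y Y' : C} {d₀ d₁ : X ⟶ W} {f g : X ⟶ Y} (h : W ⟶ Y) (r : Y ⟶ Y')
  (eta : f ⟶ d₀ ≫ h) (eps : d₁ ≫ h ⟶ g) (κ : F.map d₀ ⟶ F.map d₁) :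
  F.map₂ (eta ▷ r ≫ (α_ d₀ h r).hom) ≫ (F.mapComp d₀ (h ≫ r)).hom ≫
    κ ▷ F.map (h ≫ r) ≫ (F.mapComp d₁ (h ≫ r)).inv ≫ F.map₂ ((α_ d₁ h r).inv ≫ eps ▷ r) =
  (F.mapComp f r).hom ≫ (F.map₂ eta ≫ (F.mapComp d₀ h).hom ≫ κ ▷ F.map h ≫
    (F.mapComp d₁ h).inv ≫ F.map₂ eps) ▷ F.map r ≫ (F.mapComp g r).inv := by
  simp [aux_assoc_inv]
  rw [whisker_exchange_assoc]
  simp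
end Aux

section Hat

variable {C : Type u} [Bicategory.{w, v} C] [ModelBicategory C]
  {D : Type u₁} [Bicategory.{w₁, v₁} D]

/-- `F` maps the weak equivalences to quasiequivalences. -/
def MapsToQuasi (F : C ⥤ᵖ D) : Prop :=
  ∀ ⦃X Y : C⦄ (f : X ⟶ Y), weq f → IsQuasiequivalence (F.map f)

variable (F : C ⥤ᵖ D) (hF : MapsToQuasi F)

/-- The 2-cell `F d₀ ⟶ F d₁` induced by a σ-cylinder: the unique one whose composite with `F s`
is `F (α₁⁻¹ ∘ α₀)`. -/
noncomputable def cylCell {X : C} (c : SigmaCylinder X) : F.map c.d₀ ⟶ F.map c.d₁ :=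
  haveI := (hF c.s c.weq_s).full_postcomp (F.obj X)
  (postcomp (F.obj X) (F.map c.s)).preimage
    ((F.mapComp c.d₀ c.s).inv ≫ F.map₂ (c.α₀.hom ≫ c.α₁.inv) ≫ (F.mapComp c.d₁ c.s).hom)

theorem cylCell_spec {X : C} (c : SigmaCylinder X) :
    cylCell F hF c ▷ F.map c.s =
      (F.mapComp c.d₀ c.s).inv ≫ F.map₂ (c.α₀.hom ≫ c.α₁.inv) ≫ (F.mapComp c.d₁ c.s).hom := by
  have := (hF c.s c.weq_s).full_postcomp (F.obj X)
  exact (postcomp (F.obj X) (F.map c.s)).map_preimage _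

theorem cylCell_unique {X : C} (c : SigmaCylinder X) (κ : F.map c.d₀ ⟶ F.map c.d₁)
    (h : κ ▷ F.map c.s =
      (F.mapComp c.d₀ c.s).inv ≫ F.map₂ (c.α₀.hom ≫ c.α₁.inv) ≫ (F.mapComp c.d₁ c.s).hom) :
    cylCell F hF c = κ := by
  have := (hF c.s c.weq_s).faithful_postcomp (F.obj X)
  apply (postcomp (F.obj X) (F.map c.s)).map_injective
  exact (cylCell_spec F hF c).trans h.symm

/-- The 2-cell of `D` associated with a σ-homotopy. -/
noncomputable def hat {X Y : C} {f g : X ⟶ Y} (H : SigmaHomotopy f g) : F.map f ⟶ F.map g :=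
  F.map₂ H.eta ≫ (F.mapComp H.cyl.d₀ H.h).hom ≫ cylCell F hF H.cyl ▷ F.map H.h ≫
    (F.mapComp H.cyl.d₁ H.h).inv ≫ F.map₂ H.eps

/-- The 2-cell of `D` associated with a finite sequence of σ-homotopies. -/
noncomputable def hatSeq {X Y : C} {f g : X ⟶ Y} : HtpySeq f g → (F.map f ⟶ F.map g)
  | .nil f => 𝟙 (F.map f)
  | .cons H s => hat F hF H ≫ hatSeq s

theorem cylCell_refl (X : C) : cylCell F hF (SigmaCylinder.refl X) = 𝟙 (F.map (𝟙 X)) :=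
  cylCell_unique F hF (SigmaCylinder.refl X) _ (aux_refl F X)

theorem cylCell_whiskerLeft {X' X : C} (l : X' ⟶ X) (c : SigmaCylinder X) :
    cylCell F hF (c.whiskerLeft l) =
      (F.mapComp l c.d₀).hom ≫ F.map l ◁ cylCell F hF c ≫ (F.mapComp l c.d₁).inv :=
  cylCell_unique F hF (c.whiskerLeft l) _ (aux_left F l c.α₀ c.α₁ _ (cylCell_spec F hF c))

theorem hat_eq {X Y : C} {f g : X ⟶ Y} (H : SigmaHomotopy f g)
    (κ : F.map H.cyl.d₀ ⟶ F.map H.cyl.d₁) (h : cylCell F hF H.cyl = κ) :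
    hat F hF H = F.map₂ H.eta ≫ (F.mapComp H.cyl.d₀ H.h).hom ≫ κ ▷ F.map H.h ≫
      (F.mapComp H.cyl.d₁ H.h).inv ≫ F.map₂ H.eps := by
  subst h
  rfl

theorem hat_ofCell {X Y : C} {f g : X ⟶ Y} (μ : f ⟶ g) :
    hat F hF (SigmaHomotopy.ofCell μ) = F.map₂ μ := by
  rw [hat_eq F hF (SigmaHomotopy.ofCell μ) _ (cylCell_refl F hF X)]
  exact aux_hat_refl F μ

theorem hat_whiskerLeft {X' X Y : C} (l : X' ⟶ X) {f g : X ⟶ Y} (H : SigmaHomotopy f g) :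
    hat F hF (H.whiskerLeft l) =
      (F.mapComp l f).hom ≫ F.map l ◁ hat F hF H ≫ (F.mapComp l g).inv := by
  rw [hat_eq F hF (H.whiskerLeft l) _ (cylCell_whiskerLeft F hF l H.cyl)]
  exact aux_hat_left F l H.h H.eta H.eps _

theorem hat_whiskerRight {X Y Y' : C} {f g : X ⟶ Y} (H : SigmaHomotopy f g) (r : Y ⟶ Y') :
    hat F hF (H.whiskerRight r) =
      (F.mapComp f r).hom ≫ hat F hF H ▷ F.map r ≫ (F.mapComp g r).inv :=
  aux_hat_right F H.h r H.eta H.eps _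

theorem hatSeq_append {X Y : C} {f g h : X ⟶ Y} (s : HtpySeq f g) (t : HtpySeq g h) :
    hatSeq F hF (s.append t) = hatSeq F hF s ≫ hatSeq F hF t := by
  induction s with
  | nil => simp [HtpySeq.append, hatSeq]
  | cons H s ih => simp [HtpySeq.append, hatSeq, ih]

theorem hatSeq_whiskerLeft {X' X Y : C} (l : X' ⟶ X) {f g : X ⟶ Y} (s : HtpySeq f g) :
    hatSeq F hF (s.whiskerLeft l) =
      (F.mapComp l f).hom ≫ F.map l ◁ hatSeq F hF s ≫ (F.mapComp l g).inv := by
  induction s with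
  | nil => simp [HtpySeq.whiskerLeft, hatSeq]
  | cons H s ih => simp [HtpySeq.whiskerLeft, hatSeq, ih, hat_whiskerLeft]

theorem hatSeq_whiskerRight {X Y Y' : C} {f g : X ⟶ Y} (s : HtpySeq f g) (r : Y ⟶ Y') :
    hatSeq F hF (s.whiskerRight r) =
      (F.mapComp f r).hom ≫ hatSeq F hF s ▷ F.map r ≫ (F.mapComp g r).inv := by
  induction s with
  | nil => simp [HtpySeq.whiskerRight, hatSeq]
  | cons H s ih => simp [HtpySeq.whiskerRight, hatSeq, ih, hat_whiskerRight]

end Hat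

section HomotopyBicategory

variable {C : Type u} [Bicategory.{w, v} C] [ModelBicategory C]

/-- Two finite sequences of σ-homotopies are in the same class if they induce the same 2-cell
under every 2-functor `F : C ⥤ D` mapping the weak equivalences to quasiequivalences. The
universe levels `w₁, v₁, u₁` of the bicategories `D` are arbitrary. -/
def SameClass {X Y : C} {f g : X ⟶ Y} (s t : HtpySeq f g) : Prop :=
  ∀ (D : Type u₁) [Bicategory.{w₁, v₁} D] (F : StrictPseudofunctor C D)
    (hF : MapsToQuasi F.toPseudofunctor),
    hatSeq F.toPseudofunctor hF s = hatSeq F.toPseudofunctor hF t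

instance htpySetoid {X Y : C} (f g : X ⟶ Y) : Setoid (HtpySeq f g) where
  r := SameClass.{w₁, v₁, u₁}
  iseqv :=
    { refl := fun _ _ _ _ _ => rfl
      symm := fun h D _ F hF => (h D F hF).symm
      trans := fun h h' D _ F hF => (h D F hF).trans (h' D F hF) }

/-- The 2-cells of `Ho(C, W)`: classes of finite sequences of σ-homotopies. -/
def HoCell {X Y : C} (f g : X ⟶ Y) : Type (max u v w) :=
  Quotient (htpySetoid.{w₁, v₁, u₁} f g)

namespace HoCell

/-- The class of a finite sequence of σ-homotopies. -/
def mk {X Y : C} {f g : X ⟶ Y} (s : HtpySeq f g) : HoCell.{w₁, v₁, u₁} f g :=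
  Quotient.mk _ s

/-- The class of a σ-homotopy. -/
def ofHomotopy {X Y : C} {f g : X ⟶ Y} (H : SigmaHomotopy f g) : HoCell.{w₁, v₁, u₁} f g :=
  mk (HtpySeq.single H)

/-- The class of `I^μ`, for a 2-cell `μ` of `C`. -/
def of {X Y : C} {f g : X ⟶ Y} (μ : f ⟶ g) : HoCell.{w₁, v₁, u₁} f g :=
  ofHomotopy (SigmaHomotopy.ofCell μ)

/-- The 2-cell of `D` associated with a 2-cell of `Ho(C, W)`. -/
noncomputable def eval {D : Type u₁} [Bicategory.{w₁, v₁} D] (F : StrictPseudofunctor C D)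
    (hF : MapsToQuasi F.toPseudofunctor) {X Y : C} {f g : X ⟶ Y} (a : HoCell.{w₁, v₁, u₁} f g) :
    F.map f ⟶ F.map g :=
  Quotient.lift (fun s => hatSeq F.toPseudofunctor hF s) (fun s t (h : SameClass s t) => h D F hF) a

theorem ext {X Y : C} {f g : X ⟶ Y} {a b : HoCell.{w₁, v₁, u₁} f g}
    (h : ∀ (D : Type u₁) [Bicategory.{w₁, v₁} D] (F : StrictPseudofunctor C D)
      (hF : MapsToQuasi F.toPseudofunctor), eval F hF a = eval F hF b) : a = b := by
  induction a using Quotient.inductionOn with | h s => ?_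
  induction b using Quotient.inductionOn with | h t => ?_
  exact Quotient.sound (fun D _ F hF => h D F hF)

/-- Vertical composition: juxtaposition of sequences. -/
def comp {X Y : C} {f g h : X ⟶ Y} (a : HoCell.{w₁, v₁, u₁} f g) (b : HoCell.{w₁, v₁, u₁} g h) :
    HoCell.{w₁, v₁, u₁} f h :=
  Quotient.map₂ HtpySeq.append (fun s s' hs t t' ht D _ F hF => by
    rw [hatSeq_append, hatSeq_append, hs D F hF, ht D F hF]) a b

/-- The composite of an arrow and a 2-cell of `Ho(C, W)`. -/
def whiskerLeft {X' X Y : C} (l : X' ⟶ X) {f g : X ⟶ Y} (a : HoCell.{w₁, v₁, u₁} f g) :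
    HoCell.{w₁, v₁, u₁} (l ≫ f) (l ≫ g) :=
  Quotient.map (HtpySeq.whiskerLeft l) (fun s s' hs D _ F hF => by
    rw [hatSeq_whiskerLeft, hatSeq_whiskerLeft, hs D F hF]) a

/-- The composite of a 2-cell of `Ho(C, W)` and an arrow. -/
def whiskerRight {X Y Y' : C} {f g : X ⟶ Y} (a : HoCell.{w₁, v₁, u₁} f g) (r : Y ⟶ Y') :
    HoCell.{w₁, v₁, u₁} (f ≫ r) (g ≫ r) :=
  Quotient.map (fun s => HtpySeq.whiskerRight s r) (fun s s' hs D _ F hF => by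
    rw [hatSeq_whiskerRight, hatSeq_whiskerRight, hs D F hF]) a

section

variable {D : Type u₁} [Bicategory.{w₁, v₁} D] (F : StrictPseudofunctor C D)
    (hF : MapsToQuasi F.toPseudofunctor)

@[simp] theorem eval_of {X Y : C} {f g : X ⟶ Y} (μ : f ⟶ g) :
    eval F hF (of μ) = F.map₂ μ := by
  change hat _ hF _ ≫ 𝟙 _ = _
  rw [hat_ofCell, Category.comp_id]

@[simp] theorem eval_comp {X Y : C} {f g h : X ⟶ Y} (a : HoCell.{w₁, v₁, u₁} f g)
    (b : HoCell.{w₁, v₁, u₁} g h) : eval F hF (a.comp b) = eval F hF a ≫ eval F hF b := by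
  induction a using Quotient.inductionOn with | h s => ?_
  induction b using Quotient.inductionOn with | h t => ?_
  exact hatSeq_append _ hF s t

@[simp] theorem eval_whiskerLeft {X' X Y : C} (l : X' ⟶ X) {f g : X ⟶ Y}
    (a : HoCell.{w₁, v₁, u₁} f g) : eval F hF (a.whiskerLeft l) =
      (F.mapComp l f).hom ≫ F.map l ◁ eval F hF a ≫ (F.mapComp l g).inv := by
  induction a using Quotient.inductionOn with | h s => ?_
  exact hatSeq_whiskerLeft _ hF l s

@[simp] theorem eval_whiskerRight {X Y Y' : C} {f g : X ⟶ Y}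
    (a : HoCell.{w₁, v₁, u₁} f g) (r : Y ⟶ Y') : eval F hF (a.whiskerRight r) =
      (F.mapComp f r).hom ≫ eval F hF a ▷ F.map r ≫ (F.mapComp g r).inv := by
  induction a using Quotient.inductionOn with | h s => ?_
  exact hatSeq_whiskerRight _ hF s r

end

variable {X Y Z T V : C}

theorem of_comp {f g h : X ⟶ Y} (μ : f ⟶ g) (ν : g ⟶ h) :
    (of.{w₁, v₁, u₁} μ).comp (of ν) = of (μ ≫ ν) :=
  ext fun D _ F hF => by simp

theorem of_whiskerLeft (l : X ⟶ Y) {f g : Y ⟶ Z} (μ : f ⟶ g) :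
    (of.{w₁, v₁, u₁} μ).whiskerLeft l = of (l ◁ μ) :=
  ext fun D _ F hF => by simp

theorem of_whiskerRight {f g : X ⟶ Y} (μ : f ⟶ g) (r : Y ⟶ Z) :
    (of.{w₁, v₁, u₁} μ).whiskerRight r = of (μ ▷ r) :=
  ext fun D _ F hF => by simp

theorem id_comp {f g : X ⟶ Y} (a : HoCell.{w₁, v₁, u₁} f g) : (of (𝟙 f)).comp a = a :=
  ext fun D _ F hF => by simp

theorem comp_id {f g : X ⟶ Y} (a : HoCell.{w₁, v₁, u₁} f g) : a.comp (of (𝟙 g)) = a :=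
  ext fun D _ F hF => by simp

theorem assoc {f g h k : X ⟶ Y} (a : HoCell.{w₁, v₁, u₁} f g) (b : HoCell.{w₁, v₁, u₁} g h)
    (c : HoCell.{w₁, v₁, u₁} h k) : (a.comp b).comp c = a.comp (b.comp c) :=
  ext fun D _ F hF => by simp

theorem whiskerLeft_id (f : X ⟶ Y) (g : Y ⟶ Z) :
    (of.{w₁, v₁, u₁} (𝟙 g)).whiskerLeft f = of (𝟙 (f ≫ g)) :=
  ext fun D _ F hF => by simp

theorem whiskerLeft_comp (f : X ⟶ Y) {g h i : Y ⟶ Z} (a : HoCell.{w₁, v₁, u₁} g h)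
    (b : HoCell.{w₁, v₁, u₁} h i) :
    (a.comp b).whiskerLeft f = (a.whiskerLeft f).comp (b.whiskerLeft f) :=
  ext fun D _ F hF => by simp

theorem id_whiskerLeft {f g : X ⟶ Y} (a : HoCell.{w₁, v₁, u₁} f g) :
    a.whiskerLeft (𝟙 X) = (of (λ_ f).hom).comp (a.comp (of (λ_ g).inv)) :=
  ext fun D _ F hF => by
    simpa only [eval_of, eval_comp, eval_whiskerLeft, eval_whiskerRight] using
      aux_id_whiskerLeft F.toPseudofunctor _

theorem comp_whiskerLeft (f : X ⟶ Y) (g : Y ⟶ Z) {h h' : Z ⟶ T}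
    (a : HoCell.{w₁, v₁, u₁} h h') : a.whiskerLeft (f ≫ g) =
      (of (α_ f g h).hom).comp (((a.whiskerLeft g).whiskerLeft f).comp (of (α_ f g h').inv)) :=
  ext fun D _ F hF => by
    simpa only [eval_of, eval_comp, eval_whiskerLeft, eval_whiskerRight] using
      aux_comp_whiskerLeft F.toPseudofunctor f g _

theorem id_whiskerRight (f : X ⟶ Y) (g : Y ⟶ Z) :
    (of.{w₁, v₁, u₁} (𝟙 f)).whiskerRight g = of (𝟙 (f ≫ g)) :=
  ext fun D _ F hF => by simp

theorem comp_whiskerRight {f g h : X ⟶ Y} (a : HoCell.{w₁, v₁, u₁} f g)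
    (b : HoCell.{w₁, v₁, u₁} g h) (i : Y ⟶ Z) :
    (a.comp b).whiskerRight i = (a.whiskerRight i).comp (b.whiskerRight i) :=
  ext fun D _ F hF => by simp

theorem whiskerRight_id {f g : X ⟶ Y} (a : HoCell.{w₁, v₁, u₁} f g) :
    a.whiskerRight (𝟙 Y) = (of (ρ_ f).hom).comp (a.comp (of (ρ_ g).inv)) :=
  ext fun D _ F hF => by
    simpa only [eval_of, eval_comp, eval_whiskerLeft, eval_whiskerRight] using
      aux_whiskerRight_id F.toPseudofunctor _

theorem whiskerRight_comp {f f' : X ⟶ Y} (a : HoCell.{w₁, v₁, u₁} f f') (g : Y ⟶ Z)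
    (h : Z ⟶ T) : a.whiskerRight (g ≫ h) =
      (of (α_ f g h).inv).comp (((a.whiskerRight g).whiskerRight h).comp (of (α_ f' g h).hom)) :=
  ext fun D _ F hF => by
    simpa only [eval_of, eval_comp, eval_whiskerLeft, eval_whiskerRight] using
      aux_whiskerRight_comp F.toPseudofunctor _ g h

theorem whisker_assoc (f : X ⟶ Y) {g g' : Y ⟶ Z} (a : HoCell.{w₁, v₁, u₁} g g') (h : Z ⟶ T) :
    (a.whiskerLeft f).whiskerRight h =
      (of (α_ f g h).hom).comp (((a.whiskerRight h).whiskerLeft f).comp (of (α_ f g' h).inv)) :=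
  ext fun D _ F hF => by
    simpa only [eval_of, eval_comp, eval_whiskerLeft, eval_whiskerRight] using
      aux_whisker_assoc F.toPseudofunctor f _ h

theorem whisker_exchange {f g : X ⟶ Y} {h i : Y ⟶ Z} (a : HoCell.{w₁, v₁, u₁} f g)
    (b : HoCell.{w₁, v₁, u₁} h i) :
    (b.whiskerLeft f).comp (a.whiskerRight i) = (a.whiskerRight h).comp (b.whiskerLeft g) :=
  ext fun D _ F hF => by
    simpa only [eval_of, eval_comp, eval_whiskerLeft, eval_whiskerRight] using
      aux_whisker_exchange F.toPseudofunctor _ _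

theorem pentagon (f : X ⟶ Y) (g : Y ⟶ Z) (h : Z ⟶ T) (i : T ⟶ V) :
    ((of.{w₁, v₁, u₁} (α_ f g h).hom).whiskerRight i).comp
      ((of (α_ f (g ≫ h) i).hom).comp ((of (α_ g h i).hom).whiskerLeft f)) =
    (of (α_ (f ≫ g) h i).hom).comp (of (α_ f g (h ≫ i)).hom) := by
  simp only [of_comp, of_whiskerLeft, of_whiskerRight, Bicategory.pentagon]

theorem triangle (f : X ⟶ Y) (g : Y ⟶ Z) :
    (of.{w₁, v₁, u₁} (α_ f (𝟙 Y) g).hom).comp ((of (λ_ g).hom).whiskerLeft f) =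
      (of (ρ_ f).hom).whiskerRight g := by
  simp only [of_comp, of_whiskerLeft, of_whiskerRight, Bicategory.triangle]

end HoCell

/-- The bicategory `Ho(C, W)` of σ-homotopies; its objects are those of `C`. (As in `ULift`, the
universe of this type records the universe levels `w₁, v₁, u₁` of the bicategories that are used
to define the classes of σ-homotopies.) -/
structure SigmaHo (C : Type u) [Bicategory.{w, v} C] [ModelBicategory C] :
    Type (max u w₁ v₁ u₁) where
  as : C

namespace SigmaHo

/-- The arrows of `Ho(C, W)` are those of `C`. -/
structure Hom (X Y : SigmaHo.{w₁, v₁, u₁} C) where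
  as : X.as ⟶ Y.as

instance : CategoryStruct (SigmaHo.{w₁, v₁, u₁} C) where
  Hom X Y := Hom X Y
  id X := ⟨𝟙 X.as⟩
  comp f g := ⟨f.as ≫ g.as⟩

/-- The 2-cells of `Ho(C, W)` are the classes of finite sequences of σ-homotopies. -/
@[ext] structure Hom₂ {X Y : SigmaHo.{w₁, v₁, u₁} C} (f g : X ⟶ Y) where
  cell : HoCell.{w₁, v₁, u₁} f.as g.as

@[simps] instance (X Y : SigmaHo.{w₁, v₁, u₁} C) : Category (X ⟶ Y) where
  Hom f g := Hom₂ f g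
  id f := ⟨HoCell.of (𝟙 f.as)⟩
  comp a b := ⟨a.cell.comp b.cell⟩
  id_comp _ := Hom₂.ext (HoCell.id_comp _)
  comp_id _ := Hom₂.ext (HoCell.comp_id _)
  assoc _ _ _ := Hom₂.ext (HoCell.assoc _ _ _)

/-- The image in `Ho(C, W)` of an invertible 2-cell. -/
def isoMk {X Y : SigmaHo.{w₁, v₁, u₁} C} {f g : X ⟶ Y} (a : f.as ≅ g.as) : f ≅ g where
  hom := ⟨HoCell.of a.hom⟩
  inv := ⟨HoCell.of a.inv⟩
  hom_inv_id := Hom₂.ext ((HoCell.of_comp _ _).trans (congrArg HoCell.of a.hom_inv_id))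
  inv_hom_id := Hom₂.ext ((HoCell.of_comp _ _).trans (congrArg HoCell.of a.inv_hom_id))

instance : Bicategory (SigmaHo.{w₁, v₁, u₁} C) where
  whiskerLeft f _ _ a := Hom₂.mk (HoCell.whiskerLeft f.as (Hom₂.cell a))
  whiskerRight a f := Hom₂.mk (HoCell.whiskerRight (Hom₂.cell a) f.as)
  associator f g h := isoMk (α_ f.as g.as h.as)
  leftUnitor f := isoMk (λ_ f.as)
  rightUnitor f := isoMk (ρ_ f.as)
  whiskerLeft_id _ _ := Hom₂.ext (HoCell.whiskerLeft_id _ _)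
  whiskerLeft_comp _ _ _ _ _ _ := Hom₂.ext (HoCell.whiskerLeft_comp _ _ _)
  id_whiskerLeft _ := Hom₂.ext (HoCell.id_whiskerLeft _)
  comp_whiskerLeft _ _ _ _ _ := Hom₂.ext (HoCell.comp_whiskerLeft _ _ _)
  id_whiskerRight _ _ := Hom₂.ext (HoCell.id_whiskerRight _ _)
  comp_whiskerRight _ _ _ := Hom₂.ext (HoCell.comp_whiskerRight _ _ _)
  whiskerRight_id _ := Hom₂.ext (HoCell.whiskerRight_id _)
  whiskerRight_comp _ _ _ := Hom₂.ext (HoCell.whiskerRight_comp _ _ _)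
  whisker_assoc _ _ _ _ _ := Hom₂.ext (HoCell.whisker_assoc _ _ _)
  whisker_exchange _ _ := Hom₂.ext (HoCell.whisker_exchange _ _)
  pentagon f g h i := Hom₂.ext (HoCell.pentagon f.as g.as h.as i.as)
  triangle f g := Hom₂.ext (HoCell.triangle f.as g.as)

theorem eq_sandwich {X Y : SigmaHo.{w₁, v₁, u₁} C} {f g : X ⟶ Y} (a b : f ⟶ g) (h : a = b) :
    a = eqToHom rfl ≫ b ≫ eqToHom rfl := by
  subst h
  simp

/-- The projection 2-functor `i : C ⥤ Ho(C, W)`. -/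
def proj (C : Type u) [Bicategory.{w, v} C] [ModelBicategory C] :
    StrictPseudofunctor C (SigmaHo.{w₁, v₁, u₁} C) :=
  StrictPseudofunctor.mk'
    { obj := fun X => ⟨X⟩
      map := fun f => ⟨f⟩
      map₂ := fun μ => ⟨HoCell.of μ⟩
      map₂_id := fun _ => rfl
      map₂_comp := fun μ ν => Hom₂.ext (HoCell.of_comp μ ν).symm
      map_id := fun _ => rfl
      map_comp := fun _ _ => rfl
      map₂_whisker_left := fun f _ _ μ =>
        eq_sandwich _ _ (Hom₂.ext (HoCell.of_whiskerLeft f μ).symm)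
      map₂_whisker_right := fun μ f =>
        eq_sandwich _ _ (Hom₂.ext (HoCell.of_whiskerRight μ f).symm)
      map₂_left_unitor := fun f => by
        change (isoMk (λ_ f)).hom = 𝟙 _ ≫ (isoMk (λ_ f)).hom
        rw [Category.id_comp]
      map₂_right_unitor := fun f => by
        change (isoMk (ρ_ f)).hom = 𝟙 _ ≫ (isoMk (ρ_ f)).hom
        rw [Category.id_comp]
      map₂_associator := fun f g h => eq_sandwich _ _ rfl }

end SigmaHo

variable (C) in
/-- The fibrant-cofibrant objects of `C`. -/
structure FibCof where
  obj : C
  fibrant : IsFibrant obj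
  cofibrant : IsCofibrant obj

variable (C) in
/-- `Ho(C) = Ho_fc(C, W)`: the full sub-bicategory of `Ho(C, W)` on the fibrant-cofibrant
objects. -/
abbrev Ho : Type u :=
  InducedBicategory (SigmaHo.{w₁, v₁, u₁} C) (fun X : FibCof C => SigmaHo.mk X.obj)

namespace Ho

/-- A fibrant-cofibrant object as an object of `Ho(C)`. -/
abbrev of (X : FibCof C) : Ho.{w₁, v₁, u₁} C := X

/-- An arrow of `C` as an arrow of `Ho(C)`. -/
def homMk {X Y : FibCof C} (f : X.obj ⟶ Y.obj) : of.{w₁, v₁, u₁} X ⟶ of.{w₁, v₁, u₁} Y :=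
  InducedBicategory.mkHom (C := SigmaHo.{w₁, v₁, u₁} C)
    (F := fun X : FibCof C => SigmaHo.mk X.obj) (SigmaHo.Hom.mk f)

/-- A 2-cell of `Ho(C, W)` between arrows `f`, `g` as a 2-cell of `Ho(C)`. -/
def cellMk {X Y : FibCof C} {f g : X.obj ⟶ Y.obj} (a : HoCell.{w₁, v₁, u₁} f g) :
    homMk.{w₁, v₁, u₁} f ⟶ homMk.{w₁, v₁, u₁} g :=
  InducedBicategory.mkHom₂ (C := SigmaHo.{w₁, v₁, u₁} C)
    (F := fun X : FibCof C => SigmaHo.mk X.obj) (SigmaHo.Hom₂.mk a)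

end Ho

end HomotopyBicategory

section Replacement

variable (C : Type u) [Bicategory.{w, v} C] [ModelBicategory C]

/-- A cofibrant replacement `Q`. -/
structure CofibrantReplacement where
  obj : C → C
  p : ∀ X : C, obj X ⟶ X
  cofibrant : ∀ X : C, IsCofibrant (obj X)
  fib_p : ∀ X : C, fib (p X)
  weq_p : ∀ X : C, weq (p X)
  map : ∀ {X Y : C}, (X ⟶ Y) → (obj X ⟶ obj Y)
  rho : ∀ {X Y : C} (f : X ⟶ Y), map f ≫ p Y ≅ p X ≫ f
  map₂ : ∀ {X Y : C} {f g : X ⟶ Y}, (f ⟶ g) → (map f ⟶ map g)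
  map₂_p : ∀ {X Y : C} {f g : X ⟶ Y} (μ : f ⟶ g),
    map₂ μ ▷ p Y = (rho f).hom ≫ p X ◁ μ ≫ (rho g).inv

/-- A fibrant replacement `R`. -/
structure FibrantReplacement where
  obj : C → C
  i : ∀ X : C, X ⟶ obj X
  fibrant : ∀ X : C, IsFibrant (obj X)
  cof_i : ∀ X : C, cof (i X)
  weq_i : ∀ X : C, weq (i X)
  map : ∀ {X Y : C}, (X ⟶ Y) → (obj X ⟶ obj Y)
  lam : ∀ {X Y : C} (f : X ⟶ Y), f ≫ i Y ≅ i X ≫ map f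
  map₂ : ∀ {X Y : C} {f g : X ⟶ Y}, (f ⟶ g) → (map f ⟶ map g)
  i_map₂ : ∀ {X Y : C} {f g : X ⟶ Y} (μ : f ⟶ g),
    i X ◁ map₂ μ = (lam f).inv ≫ μ ▷ i Y ≫ (lam g).hom

variable {C}

/-- The replacement `Q` is chosen to be the identity on cofibrant objects. -/
structure CofibrantReplacement.IsNormalized (Q : CofibrantReplacement C) : Prop where
  obj_eq : ∀ X : C, IsCofibrant X → Q.obj X = X
  p_eq : ∀ X : C, IsCofibrant X → Q.p X ≍ 𝟙 X
  map_eq : ∀ {X Y : C} (f : X ⟶ Y), IsCofibrant X → IsCofibrant Y → Q.map f ≍ f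
  rho_eq : ∀ {X Y : C} (f : X ⟶ Y), IsCofibrant X → IsCofibrant Y →
    Q.rho f ≍ ρ_ f ≪≫ (λ_ f).symm
  map₂_eq : ∀ {X Y : C} {f g : X ⟶ Y} (μ : f ⟶ g), IsCofibrant X → IsCofibrant Y →
    Q.map₂ μ ≍ μ

/-- The replacement `R` is chosen to be the identity on fibrant objects. -/
structure FibrantReplacement.IsNormalized (R : FibrantReplacement C) : Prop where
  obj_eq : ∀ X : C, IsFibrant X → R.obj X = X
  i_eq : ∀ X : C, IsFibrant X → R.i X ≍ 𝟙 X
  map_eq : ∀ {X Y : C} (f : X ⟶ Y), IsFibrant X → IsFibrant Y → R.map f ≍ f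
  lam_eq : ∀ {X Y : C} (f : X ⟶ Y), IsFibrant X → IsFibrant Y →
    R.lam f ≍ ρ_ f ≪≫ (λ_ f).symm
  map₂_eq : ∀ {X Y : C} {f g : X ⟶ Y} (μ : f ⟶ g), IsFibrant X → IsFibrant Y →
    R.map₂ μ ≍ μ

variable (Q : CofibrantReplacement C) (R : FibrantReplacement C)

/-- The fibrant-cofibrant object `RQX`. -/
def replacementObj (X : C) : FibCof C where
  obj := R.obj (Q.obj X)
  fibrant := R.fibrant _
  cofibrant := (Q.cofibrant X).of_cof (R.i _) (R.cof_i _)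

/-- The assignation `X ↦ RQX`, `f ↦ RQf`, `μ ↦ i(RQμ)` on objects, arrows and 2-cells. -/
def replacementCells : PrelaxFunctorStruct C (Ho.{w₁, v₁, u₁} C) where
  obj X := Ho.of (replacementObj Q R X)
  map f := Ho.homMk (R.map (Q.map f))
  map₂ μ := Ho.cellMk ((SigmaHo.proj.{w₁, v₁, u₁} C).map₂ (R.map₂ (Q.map₂ μ))).cell

/-- The class in `Ho(C, W)` of a w-homotopy. -/
def WHomotopy.cls {X Y : C} {f g : X ⟶ Y} (H : WHomotopy f g) : HoCell.{w₁, v₁, u₁} f g :=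
  HoCell.ofHomotopy H.toSigma

open HoCell

namespace CofibrantReplacement

/-- `b : id_{QX} ⇒ Qf` is obtained by applying the replacement to `a : id_X ⇒ f`, i.e.
`p_X * b = ρ_f⁻¹ ∘ a * p_X`. -/
def IsXi {X : C} {f : X ⟶ X} (a : HoCell.{w₁, v₁, u₁} (𝟙 X) f)
    (b : HoCell.{w₁, v₁, u₁} (𝟙 (Q.obj X)) (Q.map f)) : Prop :=
  b.whiskerRight (Q.p X) =
    (of ((λ_ (Q.p X)).hom ≫ (ρ_ (Q.p X)).inv)).comp
      ((a.whiskerLeft (Q.p X)).comp (of (Q.rho f).inv))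

/-- `b : Qg * Qf ⇒ Ql` is obtained by applying the replacement to `a : g * f ⇒ l`, i.e.
`p_Z * b = ρ_l⁻¹ ∘ a * p_X ∘ g * ρ_f ∘ ρ_g * Qf`. -/
def IsPhi {X Y Z : C} {f : X ⟶ Y} {g : Y ⟶ Z} {l : X ⟶ Z} (a : HoCell.{w₁, v₁, u₁} (f ≫ g) l)
    (b : HoCell.{w₁, v₁, u₁} (Q.map f ≫ Q.map g) (Q.map l)) : Prop :=
  b.whiskerRight (Q.p Z) =
    (of ((α_ (Q.map f) (Q.map g) (Q.p Z)).hom ≫ Q.map f ◁ (Q.rho g).hom ≫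
      (α_ (Q.map f) (Q.p Y) g).inv ≫ (Q.rho f).hom ▷ g ≫ (α_ (Q.p X) f g).hom)).comp
      ((a.whiskerLeft (Q.p X)).comp (of (Q.rho l).inv))

end CofibrantReplacement

namespace FibrantReplacement

/-- `b : id_{RX} ⇒ Rf` is obtained by applying the replacement to `a : id_X ⇒ f`, i.e.
`b * i_X = λ_f ∘ i_X * a`. -/
def IsXi {X : C} {f : X ⟶ X} (a : HoCell.{w₁, v₁, u₁} (𝟙 X) f)
    (b : HoCell.{w₁, v₁, u₁} (𝟙 (R.obj X)) (R.map f)) : Prop :=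
  b.whiskerLeft (R.i X) =
    (of ((ρ_ (R.i X)).hom ≫ (λ_ (R.i X)).inv)).comp
      ((a.whiskerRight (R.i X)).comp (of (R.lam f).hom))

/-- `b : Rg * Rf ⇒ Rl` is obtained by applying the replacement to `a : g * f ⇒ l`, i.e.
`b * i_X = λ_l ∘ i_Z * a ∘ λ_g⁻¹ * f ∘ Rg * λ_f⁻¹`. -/
def IsPhi {X Y Z : C} {f : X ⟶ Y} {g : Y ⟶ Z} {l : X ⟶ Z} (a : HoCell.{w₁, v₁, u₁} (f ≫ g) l)
    (b : HoCell.{w₁, v₁, u₁} (R.map f ≫ R.map g) (R.map l)) : Prop :=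
  b.whiskerLeft (R.i X) =
    (of ((α_ (R.i X) (R.map f) (R.map g)).inv ≫ (R.lam f).inv ▷ R.map g ≫
      (α_ f (R.i Y) (R.map g)).hom ≫ f ◁ (R.lam g).inv ≫ (α_ f g (R.i Z)).inv)).comp
      ((a.whiskerRight (R.i Z)).comp (of (R.lam l).hom))

end FibrantReplacement

end Replacement

end ModelBicat

/-! In `SigmaHo`, whiskering with a weak equivalence, on either side, is injective on 2-cells:
classes are separated by 2-functors that turn it into a quasiequivalence. The arrows of the span X ←
QX → RQX are weak equivalences, and `rho` and `lam` are squares linking f to Qf and Qf to RQf. Hence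
over a 2-cell between arrows X ⟶ Y there is at most one compatible 2-cell between the arrows QX ⟶
QY, and for that one at most one compatible 2-cell between the arrows RQX ⟶ RQY
(`CompatSpan.unique`). Compatibility is stable under composition, whiskering and pasting of squares,
and holds for associators and unitors. The structural 2-cells lie over identities, so both sides of
each pseudofunctor axiom lie over 2-cells whose equality is an instance of a bicategory law.

The structural 2-cells come from two constructions. `exists_wHomotopy_whiskerRight` lifts an
invertible 2-cell through a trivial fibration p: the arrow [u, v] on A ⨿ A is extended to a cylinder
W by the lifting property, and since the lift composed with p factors through s : W ⟶ A, the
homotopy becomes the class of a 2-cell after whiskering with p. `exists_wHomotopy_whiskerLeft`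
extends a homotopy along a trivial cofibration A ⟶ A': the cylinder is pushed out along A ⨿ A ⟶ A' ⨿
A', so the extension is given by a universal property and needs no fibrancy of the target. All
computations with classes go through `SigmaCylinder.cell`, the invertible 2-cell d₀ ⟶ d₁ determined
by its whiskering with s.

Replacements exist by lifting against 0 ⟶ QX and against RX ⟶ *; normalization is a case distinction
made object by object and arrow by arrow. -/

namespace ModelBicat

open ModelBicategory

/-! ### Squares up to invertible 2-cells, and compatible pairs of 2-cells -/

section Squares

variable {B : Type u} [Bicategory.{w, v} B]

variable {X X' Y Y' Z Z' T T₁ : B} {a : X ⟶ X'} {b : Y ⟶ Y'} {c : Z ⟶ Z'} {d : T ⟶ T₁}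

/-- The identity square with vertical arrow `a`. -/
def squareId (a : X ⟶ X') : 𝟙 X ≫ a ≅ a ≫ 𝟙 X' :=
  λ_ a ≪≫ (ρ_ a).symm

@[simp] theorem squareId_hom (a : X ⟶ X') : (squareId a).hom = (λ_ a).hom ≫ (ρ_ a).inv := rfl

/-- Horizontal pasting of squares that commute up to invertible 2-cells. -/
def squareComp {m : X ⟶ Y} {n : X' ⟶ Y'} {m' : Y ⟶ Z} {n' : Y' ⟶ Z'}
    (s : m ≫ b ≅ a ≫ n) (t : m' ≫ c ≅ b ≫ n') : (m ≫ m') ≫ c ≅ a ≫ n ≫ n' :=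
  α_ m m' c ≪≫ whiskerLeftIso m t ≪≫ (α_ m b n').symm ≪≫ whiskerRightIso s n' ≪≫ α_ a n n'

@[simp] theorem squareComp_hom {m : X ⟶ Y} {n : X' ⟶ Y'} {m' : Y ⟶ Z} {n' : Y' ⟶ Z'}
    (s : m ≫ b ≅ a ≫ n) (t : m' ≫ c ≅ b ≫ n') : (squareComp s t).hom =
      (α_ m m' c).hom ≫ m ◁ t.hom ≫ (α_ m b n').inv ≫ s.hom ▷ n' ≫ (α_ a n n').hom := rfl

/-- The 2-cells `κ`, `τ` between the horizontal arrows of two squares are compatible. -/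
def Compat {m₁ m₂ : X ⟶ Y} {n₁ n₂ : X' ⟶ Y'} (s : m₁ ≫ b ≅ a ≫ n₁) (t : m₂ ≫ b ≅ a ≫ n₂)
    (κ : m₁ ⟶ m₂) (τ : n₁ ⟶ n₂) : Prop :=
  κ ▷ b ≫ t.hom = s.hom ≫ a ◁ τ

namespace Compat

variable {m₁ m₂ m₃ : X ⟶ Y} {n₁ n₂ n₃ : X' ⟶ Y'} {s : m₁ ≫ b ≅ a ≫ n₁} {t : m₂ ≫ b ≅ a ≫ n₂}
  {q : m₃ ≫ b ≅ a ≫ n₃}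

theorem refl (s : m₁ ≫ b ≅ a ≫ n₁) : Compat s s (𝟙 _) (𝟙 _) := by simp [Compat]

theorem trans {κ : m₁ ⟶ m₂} {τ : n₁ ⟶ n₂} {κ' : m₂ ⟶ m₃} {τ' : n₂ ⟶ n₃}
    (h : Compat s t κ τ) (h' : Compat t q κ' τ') : Compat s q (κ ≫ κ') (τ ≫ τ') := by
  unfold Compat at *
  rw [comp_whiskerRight, Category.assoc, h', reassoc_of% h, Bicategory.whiskerLeft_comp]

theorem symm {κ : m₁ ≅ m₂} {τ : n₁ ≅ n₂}
    (h : Compat s t κ.hom τ.hom) : Compat t s κ.inv τ.inv := by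
  unfold Compat at *
  rw [← cancel_epi (κ.hom ▷ b), hom_inv_whiskerRight_assoc, reassoc_of% h, whiskerLeft_hom_inv,
    Category.comp_id]

theorem whiskerLeft {m₀ : T ⟶ X} {n₀ : T₁ ⟶ X'} (r : m₀ ≫ a ≅ d ≫ n₀) {κ : m₁ ⟶ m₂} {τ : n₁ ⟶ n₂}
    (h : Compat s t κ τ) : Compat (squareComp r s) (squareComp r t) (m₀ ◁ κ) (n₀ ◁ τ) := by
  unfold Compat at *
  have := congrArg (m₀ ◁ ·) h
  simp only [Bicategory.whiskerLeft_comp] at this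
  have e := whisker_exchange r.hom τ
  simp only [comp_whiskerLeft, Category.assoc] at e
  rw [← cancel_mono (α_ d n₀ n₂).inv]
  simp [reassoc_of% this, ← e]

theorem whiskerRight {κ : m₁ ⟶ m₂} {τ : n₁ ⟶ n₂} (h : Compat s t κ τ)
    {m₀ : Y ⟶ Z} {n₀ : Y' ⟶ Z'} (r : m₀ ≫ c ≅ b ≫ n₀) :
    Compat (squareComp s r) (squareComp t r) (κ ▷ m₀) (τ ▷ n₀) := by
  unfold Compat at *
  have := congrArg (· ▷ n₀) h
  simp only [comp_whiskerRight] at this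
  have e := whisker_exchange κ r.hom
  simp only [whiskerRight_comp, Category.assoc] at e
  rw [← cancel_epi (α_ m₁ m₀ c).inv]
  simp [← reassoc_of% e, reassoc_of% this]

/-- The two pastings contain the same three squares, so they differ by coherence cells only. -/
theorem associator {m : X ⟶ Y} {n : X' ⟶ Y'} {m' : Y ⟶ Z} {n' : Y' ⟶ Z'} {m'' : Z ⟶ T}
    {n'' : Z' ⟶ T₁} (s : m ≫ b ≅ a ≫ n) (t : m' ≫ c ≅ b ≫ n') (q : m'' ≫ d ≅ c ≫ n'') :
    Compat (squareComp (squareComp s t) q) (squareComp s (squareComp t q))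
      (α_ _ _ _).hom (α_ _ _ _).hom := by
  simp [Compat]

theorem leftUnitor (s : m₁ ≫ b ≅ a ≫ n₁) :
    Compat (squareComp (squareId a) s) s (λ_ _).hom (λ_ _).hom := by
  simp [Compat]

theorem rightUnitor (s : m₁ ≫ b ≅ a ≫ n₁) :
    Compat (squareComp s (squareId b)) s (ρ_ _).hom (ρ_ _).hom := by
  simp [Compat]

/-- The condition `hb` is faithfulness of whiskering with `b`; it will be supplied by the weak
equivalence p_Y. -/
theorem top_unique {κ κ' : m₁ ⟶ m₂} {τ : n₁ ⟶ n₂}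
    (hb : ∀ κ κ' : m₁ ⟶ m₂, κ ▷ b = κ' ▷ b → κ = κ')
    (h : Compat s t κ τ) (h' : Compat s t κ' τ) : κ = κ' := by
  apply hb
  rw [← cancel_mono t.hom]
  exact Eq.trans h (Eq.symm h')

/-- Here `ha` will be supplied by the weak equivalence from QX to RQX. -/
theorem bot_unique {κ : m₁ ⟶ m₂} {τ τ' : n₁ ⟶ n₂}
    (ha : ∀ τ τ' : n₁ ⟶ n₂, a ◁ τ = a ◁ τ' → τ = τ')
    (h : Compat s t κ τ) (h' : Compat s t κ τ') : τ = τ' := by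
  apply ha
  rw [← cancel_epi s.hom]
  exact Eq.trans (Eq.symm h) h'

end Compat

end Squares

/-! ### The 2-cell of a cylinder in Ho(C, W) -/

section CylinderCells

variable {C : Type u} [Bicategory.{w, v} C] [ModelBicategory C]

namespace HoCell

/-- Under each test 2-functor the equation becomes one between whiskerings with the quasiequivalence
F r, conjugated by the invertible `mapComp` cells, which cancel. -/
theorem whiskerRight_injective {X Y Y' : C} {f g : X ⟶ Y} {r : Y ⟶ Y'} (hr : weq r)
    {a b : HoCell.{w₁, v₁, u₁} f g} (h : a.whiskerRight r = b.whiskerRight r) : a = b := by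
  refine ext fun D _ F hF => ?_
  have h' := congrArg (eval F hF) h
  rw [eval_whiskerRight, eval_whiskerRight, cancel_epi, cancel_mono] at h'
  have := (hF r hr).faithful_postcomp (F.obj X)
  exact (postcomp (F.obj X) (F.map r)).map_injective h'

theorem whiskerLeft_injective {X X' Y : C} {f g : X ⟶ Y} {l : X' ⟶ X} (hl : weq l)
    {a b : HoCell.{w₁, v₁, u₁} f g} (h : a.whiskerLeft l = b.whiskerLeft l) : a = b := by
  refine ext fun D _ F hF => ?_
  have h' := congrArg (eval F hF) h
  rw [eval_whiskerLeft, eval_whiskerLeft, cancel_epi, cancel_mono] at h'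
  have := (hF l hl).faithful_precomp (F.obj Y)
  exact (precomp (F.obj Y) (F.map l)).map_injective h'

end HoCell

/-- The homotopy from `d₀` to `d₁` given by a σ-cylinder. -/
@[simps] def SigmaCylinder.homotopy {X : C} (c : SigmaCylinder X) : SigmaHomotopy c.d₀ c.d₁ where
  cyl := c
  h := 𝟙 c.W
  eta := (ρ_ _).inv
  eps := (ρ_ _).hom

/-- The σ-cylinder with `d₀` and `d₁` exchanged. -/
@[simps] def SigmaCylinder.swap {X : C} (c : SigmaCylinder X) : SigmaCylinder X where
  W := c.W
  Z := c.Z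
  d₀ := c.d₁
  d₁ := c.d₀
  x := c.x
  s := c.s
  weq_s := c.weq_s
  α₀ := c.α₁
  α₁ := c.α₀

/-- The 2-cell `d₀ ⟶ d₁` of `Ho(C, W)` given by a σ-cylinder. -/
def SigmaCylinder.cell {X : C} (c : SigmaCylinder X) : HoCell.{w₁, v₁, u₁} c.d₀ c.d₁ :=
  HoCell.ofHomotopy c.homotopy

open HoCell

/-- Whiskering with F of an identity only adds unitors, and these cancel against `eta` and `eps`. -/
theorem hat_homotopy {D : Type u₁} [Bicategory.{w₁, v₁} D] (F : C ⥤ᵖ D) (hF : MapsToQuasi F)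
    {X : C} (c : SigmaCylinder X) : hat F hF c.homotopy = cylCell F hF c := by
  have := aux_whiskerRight_id F (cylCell F hF c)
  unfold hat
  simp only [SigmaCylinder.homotopy]
  rw [reassoc_of% this, ← F.map₂_comp]
  simp only [Iso.inv_hom_id, F.map₂_id, Category.comp_id]
  rw [← F.map₂_comp_assoc]
  simp

@[simp] theorem eval_cell {D : Type u₁} [Bicategory.{w₁, v₁} D] (F : StrictPseudofunctor C D)
    (hF : MapsToQuasi F.toPseudofunctor) {X : C} (c : SigmaCylinder X) :
    eval F hF c.cell = cylCell F.toPseudofunctor hF c := by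
  change hat _ hF _ ≫ 𝟙 _ = _
  rw [hat_homotopy, Category.comp_id]

@[simp] theorem eval_ofHomotopy {D : Type u₁} [Bicategory.{w₁, v₁} D] (F : StrictPseudofunctor C D)
    (hF : MapsToQuasi F.toPseudofunctor) {X Y : C} {f g : X ⟶ Y} (H : SigmaHomotopy f g) :
    eval F hF (ofHomotopy H) = hat F.toPseudofunctor hF H := by
  change hat _ hF _ ≫ 𝟙 _ = _
  rw [Category.comp_id]

/-- Reduces every homotopy to the 2-cell of its cylinder, so that later arguments stay inside Ho(C,
W) and do not mention test 2-functors. -/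
theorem ofHomotopy_eq {X Y : C} {f g : X ⟶ Y} (H : SigmaHomotopy f g) :
    ofHomotopy.{w₁, v₁, u₁} H =
      (of H.eta).comp ((H.cyl.cell.whiskerRight H.h).comp (of H.eps)) :=
  ext fun D _ F hF => by simp [hat]

/-- The defining equation of `cylCell`, valid for every test 2-functor. As `s` is a weak
equivalence, it characterises the cell. -/
theorem cell_whiskerRight_s {X : C} (c : SigmaCylinder X) :
    c.cell.{w₁, v₁, u₁}.whiskerRight c.s = of (c.α₀.hom ≫ c.α₁.inv) :=
  ext fun D _ F hF => by
    rw [eval_whiskerRight, eval_cell, cylCell_spec, eval_of, Category.assoc, Category.assoc,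
      Iso.hom_inv_id_assoc, Iso.hom_inv_id, Category.comp_id]

/-- The 2-cell `d₁ ⟶ d₀` of `Ho(C, W)` given by a σ-cylinder. -/
def SigmaCylinder.cellInv {X : C} (c : SigmaCylinder X) : HoCell.{w₁, v₁, u₁} c.d₁ c.d₀ :=
  c.swap.cell

theorem cellInv_whiskerRight_s {X : C} (c : SigmaCylinder X) :
    c.cellInv.{w₁, v₁, u₁}.whiskerRight c.s = of (c.α₁.hom ≫ c.α₀.inv) :=
  cell_whiskerRight_s c.swap

/-- After whiskering with `s` the two factors become α₁⁻¹ ∘ α₀ and its inverse. -/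
theorem cell_comp_cellInv {X : C} (c : SigmaCylinder X) :
    c.cell.{w₁, v₁, u₁}.comp c.cellInv = of (𝟙 _) := by
  apply whiskerRight_injective c.weq_s
  rw [HoCell.comp_whiskerRight, cell_whiskerRight_s, cellInv_whiskerRight_s,
    HoCell.id_whiskerRight, of_comp]
  simp

theorem cellInv_comp_cell {X : C} (c : SigmaCylinder X) :
    c.cellInv.{w₁, v₁, u₁}.comp c.cell = of (𝟙 _) :=
  cell_comp_cellInv c.swap

theorem cell_whiskerRight_congr {X : C} (c : SigmaCylinder X) {Y : C} {h h' : c.W ⟶ Y}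
    (e : h ≅ h') : c.cell.{w₁, v₁, u₁}.whiskerRight h =
      (of (c.d₀ ◁ e.hom)).comp ((c.cell.whiskerRight h').comp (of (c.d₁ ◁ e.inv))) := by
  rw [← of_whiskerLeft, ← of_whiskerLeft, ← HoCell.assoc, HoCell.whisker_exchange, HoCell.assoc,
    ← HoCell.whiskerLeft_comp, of_comp, e.hom_inv_id, HoCell.whiskerLeft_id, HoCell.comp_id]

/-- An arrow out of the cylinder that factors through `s` sees only the whiskering of the cell with
`s`, which comes from `C`. -/
theorem cell_whiskerRight {X : C} (c : SigmaCylinder X) {Y : C} {h : c.W ⟶ Y} {t : c.Z ⟶ Y}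
    (e : h ≅ c.s ≫ t) : c.cell.{w₁, v₁, u₁}.whiskerRight h =
      of (c.d₀ ◁ e.hom ≫ (α_ _ _ _).inv ≫ c.α₀.hom ▷ t ≫ c.α₁.inv ▷ t ≫ (α_ _ _ _).hom ≫
        c.d₁ ◁ e.inv) := by
  rw [cell_whiskerRight_congr c e, HoCell.whiskerRight_comp, cell_whiskerRight_s, of_whiskerRight]
  simp [of_comp]

/-- The class of a homotopy with invertible cells is invertible. -/
theorem ofHomotopy_invertible {X Y : C} {f g : X ⟶ Y} (H : SigmaHomotopy f g)
    (h₀ : IsIso H.eta) (h₁ : IsIso H.eps) : ∃ b : HoCell.{w₁, v₁, u₁} g f,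
      (ofHomotopy H).comp b = of (𝟙 f) ∧ b.comp (ofHomotopy H) = of (𝟙 g) := by
  -- The inverse runs through the same cylinder with its ends exchanged.
  refine ⟨(of (inv H.eps)).comp ((H.cyl.cellInv.whiskerRight H.h).comp (of (inv H.eta))), ?_, ?_⟩
  · have e₁ : (of.{w₁, v₁, u₁} H.eps).comp (of (inv H.eps)) = of (𝟙 _) := by simp [of_comp]
    rw [ofHomotopy_eq, HoCell.assoc, HoCell.assoc, ← HoCell.assoc (of H.eps), e₁, HoCell.id_comp,
      ← HoCell.assoc _ _ (of _), ← HoCell.comp_whiskerRight, cell_comp_cellInv,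
      HoCell.id_whiskerRight, HoCell.id_comp, of_comp, IsIso.hom_inv_id]
  · have e₁ : (of.{w₁, v₁, u₁} (inv H.eta)).comp (of H.eta) = of (𝟙 _) := by simp [of_comp]
    rw [ofHomotopy_eq, HoCell.assoc, HoCell.assoc, ← HoCell.assoc (of (inv H.eta)), e₁,
      HoCell.id_comp, ← HoCell.assoc _ _ (of _), ← HoCell.comp_whiskerRight, cellInv_comp_cell,
      HoCell.id_whiskerRight, HoCell.id_comp, of_comp, IsIso.inv_hom_id]

/-- If `h ≫ p` factors through `s`, then the class of a homotopy becomes the class of a 2-cell of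
`C` after whiskering with `p`. -/
theorem ofHomotopy_whiskerRight {X Y B : C} {f g : X ⟶ Y} (H : SigmaHomotopy f g) {p : Y ⟶ B}
    {t : H.cyl.Z ⟶ B} (e : H.h ≫ p ≅ H.cyl.s ≫ t) :
    (ofHomotopy.{w₁, v₁, u₁} H).whiskerRight p =
      of ((H.eta ▷ p ≫ (α_ _ _ _).hom ≫ H.cyl.d₀ ◁ e.hom ≫ (α_ _ _ _).inv ≫ H.cyl.α₀.hom ▷ t) ≫
        (H.cyl.α₁.inv ▷ t ≫ (α_ _ _ _).hom ≫ H.cyl.d₁ ◁ e.inv ≫ (α_ _ _ _).inv ≫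
          H.eps ▷ p)) := by
  have h := HoCell.whiskerRight_comp H.cyl.cell.{w₁, v₁, u₁} H.h p
  rw [cell_whiskerRight H.cyl e] at h
  have h' : (H.cyl.cell.{w₁, v₁, u₁}.whiskerRight H.h).whiskerRight p =
      (of (α_ _ _ _).hom).comp (((of (α_ _ _ _).inv).comp
        (((H.cyl.cell.{w₁, v₁, u₁}.whiskerRight H.h).whiskerRight p).comp
          (of (α_ _ _ _).hom))).comp (of (α_ _ _ _).inv)) := by
    rw [HoCell.assoc, HoCell.assoc, of_comp, Iso.hom_inv_id, HoCell.comp_id, ← HoCell.assoc,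
      of_comp, Iso.hom_inv_id, HoCell.id_comp]
  rw [← h] at h'
  rw [ofHomotopy_eq, HoCell.comp_whiskerRight, HoCell.comp_whiskerRight, h']
  simp only [of_comp, of_whiskerRight, Category.assoc]

section CylinderMaps

variable {A A' : C} {i : A ⟶ A'} {c : SigmaCylinder A} {c' : SigmaCylinder A'}
  {j : c.W ⟶ c'.W} (θ₀ : i ≫ c'.d₀ ≅ c.d₀ ≫ j) (θ₁ : i ≫ c'.d₁ ≅ c.d₁ ≫ j)

/-- The naturality of the 2-cells given by σ-cylinders. -/
theorem cell_whiskerLeft {k : c.Z ⟶ c'.Z} (ψ : j ≫ c'.s ≅ c.s ≫ k) (ζ : c.x ≫ k ≅ i ≫ c'.x)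
    (h₀ : θ₀.hom ▷ c'.s ≫ (α_ _ _ _).hom ≫ c.d₀ ◁ ψ.hom ≫ (α_ _ _ _).inv ≫
      c.α₀.hom ▷ k ≫ ζ.hom = (α_ _ _ _).hom ≫ i ◁ c'.α₀.hom)
    (h₁ : θ₁.hom ▷ c'.s ≫ (α_ _ _ _).hom ≫ c.d₁ ◁ ψ.hom ≫ (α_ _ _ _).inv ≫
      c.α₁.hom ▷ k ≫ ζ.hom = (α_ _ _ _).hom ≫ i ◁ c'.α₁.hom) :
    c'.cell.{w₁, v₁, u₁}.whiskerLeft i =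
      (of θ₀.hom).comp ((c.cell.whiskerRight j).comp (of θ₁.inv)) := by
  -- After whiskering with `c'.s` all cells are images of 2-cells of `C`, where `h₀` and `h₁` decide
  -- the equation.
  apply whiskerRight_injective c'.weq_s
  have e₁ : (c.cell.{w₁, v₁, u₁}.whiskerRight j).whiskerRight c'.s =
      (of (α_ _ _ _).hom).comp ((c.cell.whiskerRight (j ≫ c'.s)).comp (of (α_ _ _ _).inv)) := by
    rw [HoCell.whiskerRight_comp, HoCell.assoc, HoCell.assoc, of_comp, Iso.hom_inv_id,
      HoCell.comp_id, ← HoCell.assoc, of_comp, Iso.hom_inv_id, HoCell.id_comp]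
  rw [HoCell.whisker_assoc, cell_whiskerRight_s, HoCell.comp_whiskerRight,
    HoCell.comp_whiskerRight, e₁, cell_whiskerRight c ψ]
  simp only [of_comp, of_whiskerRight, of_whiskerLeft]
  congr 1
  -- The condition `h₁` solved for the inverse of `c'.α₁`, the form in which it enters the cell.
  have h₁' : i ◁ c'.α₁.inv ≫ (α_ _ _ _).inv = ζ.inv ≫ c.α₁.inv ▷ k ≫ (α_ _ _ _).hom ≫
      c.d₁ ◁ ψ.inv ≫ (α_ _ _ _).inv ≫ θ₁.inv ▷ c'.s := by
    rw [← cancel_epi ((α_ _ _ _).hom ≫ i ◁ c'.α₁.hom)]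
    nth_rw 2 [← h₁]
    simp
  rw [Bicategory.whiskerLeft_comp, Category.assoc, h₁', ← reassoc_of% h₀]
  simp

/-- Once the cell of `c'` restricted along `i` is expressed by the cell of `c`, a homotopy on `c'`
restricts to one on `c`; the comparisons θ₀, θ₁ and χ are absorbed into `eta` and `eps`. -/
theorem ofHomotopy_whiskerLeft
    (h₀ : c'.cell.{w₁, v₁, u₁}.whiskerLeft i =
      (of θ₀.hom).comp ((c.cell.whiskerRight j).comp (of θ₁.inv)))
    {B : C} {h : c.W ⟶ B} {h' : c'.W ⟶ B} (χ : j ≫ h' ≅ h) {u v : A' ⟶ B}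
    (eta : u ⟶ c'.d₀ ≫ h') (eps : c'.d₁ ≫ h' ⟶ v) :
    (ofHomotopy.{w₁, v₁, u₁} ⟨c', h', eta, eps⟩).whiskerLeft i =
      ofHomotopy ⟨c, h, i ◁ eta ≫ (α_ _ _ _).inv ≫ θ₀.hom ▷ h' ≫ (α_ _ _ _).hom ≫ c.d₀ ◁ χ.hom,
        c.d₁ ◁ χ.inv ≫ (α_ _ _ _).inv ≫ θ₁.inv ▷ h' ≫ (α_ _ _ _).hom ≫ i ◁ eps⟩ := by
  have e₁ : (c.cell.{w₁, v₁, u₁}.whiskerRight j).whiskerRight h' =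
      (of (α_ _ _ _).hom).comp ((c.cell.whiskerRight (j ≫ h')).comp (of (α_ _ _ _).inv)) := by
    rw [HoCell.whiskerRight_comp, HoCell.assoc, HoCell.assoc, of_comp, Iso.hom_inv_id,
      HoCell.comp_id, ← HoCell.assoc, of_comp, Iso.hom_inv_id, HoCell.id_comp]
  have e₂ : (c'.cell.{w₁, v₁, u₁}.whiskerRight h').whiskerLeft i =
      (of (α_ _ _ _).inv).comp (((c'.cell.whiskerLeft i).whiskerRight h').comp
        (of (α_ _ _ _).hom)) := by
    rw [HoCell.whisker_assoc, HoCell.assoc, HoCell.assoc, of_comp, Iso.inv_hom_id,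
      HoCell.comp_id, ← HoCell.assoc, of_comp, Iso.inv_hom_id, HoCell.id_comp]
  rw [ofHomotopy_eq, ofHomotopy_eq, HoCell.whiskerLeft_comp, HoCell.whiskerLeft_comp, e₂, h₀,
    HoCell.comp_whiskerRight, HoCell.comp_whiskerRight, e₁, cell_whiskerRight_congr c χ]
  simp only [of_whiskerLeft, of_whiskerRight, HoCell.assoc, ← of_comp]

end CylinderMaps

end CylinderCells

/-! ### Bicategorical coproducts -/

section Bicoproducts

variable {C : Type u} [Bicategory.{w, v} C]

theorem IsBiinitial.hom_ext {I X : C} (hI : IsBiinitial I) {f g : I ⟶ X} (a b : f ⟶ g) : a = b :=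
  (hI.unique₂ f g).elim fun u => (u.uniq a).trans (u.uniq b).symm

theorem IsBiinitial.exists_iso {I X : C} (hI : IsBiinitial I) (f g : I ⟶ X) :
    Nonempty (f ≅ g) :=
  (hI.unique₂ f g).elim fun u => (hI.unique₂ g f).elim fun u' =>
    ⟨⟨u.default, u'.default, hI.hom_ext _ _, hI.hom_ext _ _⟩⟩

theorem IsBiterminal.hom_ext {T X : C} (hT : IsBiterminal T) {f g : X ⟶ T} (a b : f ⟶ g) :
    a = b :=
  (hT.unique₂ f g).elim fun u => (u.uniq a).trans (u.uniq b).symm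

theorem IsBiterminal.exists_iso {T X : C} (hT : IsBiterminal T) (f g : X ⟶ T) :
    Nonempty (f ≅ g) :=
  (hT.unique₂ f g).elim fun u => (hT.unique₂ g f).elim fun u' =>
    ⟨⟨u.default, u'.default, hT.hom_ext _ _, hT.hom_ext _ _⟩⟩

/-- Over an initial object the comparison 2-cell exists and every compatibility condition between
2-cells is automatic. -/
theorem IsBipushout.isBicoproduct {I X Y S : C} (hI : IsBiinitial I) {x : I ⟶ X} {y : I ⟶ Y}
    {i₀ : X ⟶ S} {i₁ : Y ⟶ S} {γ : x ≫ i₀ ≅ y ≫ i₁} (h : IsBipushout γ) :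
    IsBicoproduct i₀ i₁ where
  desc f g := by
    obtain ⟨δ⟩ := hI.exists_iso (x ≫ f) (y ≫ g)
    obtain ⟨k, σ, τ, -⟩ := h.desc f g δ
    exact ⟨k, ⟨σ⟩, ⟨τ⟩⟩
  desc₂ k l σ τ := h.desc₂ k l σ τ (hI.hom_ext _ _)

namespace IsBicoproduct

variable {X Y S Z : C} {i₀ : X ⟶ S} {i₁ : Y ⟶ S}

theorem symm (h : IsBicoproduct i₀ i₁) : IsBicoproduct i₁ i₀ where
  desc f g := by
    obtain ⟨k, a, b⟩ := h.desc g f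
    exact ⟨k, b, a⟩
  desc₂ k l σ τ := by
    obtain ⟨θ, ⟨a, b⟩, u⟩ := h.desc₂ k l τ σ
    exact ⟨θ, ⟨b, a⟩, fun θ' hθ => u θ' ⟨hθ.2, hθ.1⟩⟩

theorem hom_ext (h : IsBicoproduct i₀ i₁) {k l : S ⟶ Z}
    {θ θ' : k ⟶ l} (h₀ : i₀ ◁ θ = i₀ ◁ θ') (h₁ : i₁ ◁ θ = i₁ ◁ θ') :
    θ = θ' :=
  (h.desc₂ k l (i₀ ◁ θ') (i₁ ◁ θ')).unique ⟨h₀, h₁⟩ ⟨rfl, rfl⟩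

theorem exists_iso (h : IsBicoproduct i₀ i₁) {k l : S ⟶ Z}
    (σ : i₀ ≫ k ≅ i₀ ≫ l) (τ : i₁ ≫ k ≅ i₁ ≫ l) :
    ∃ Θ : k ≅ l, i₀ ◁ Θ.hom = σ.hom ∧ i₁ ◁ Θ.hom = τ.hom := by
  obtain ⟨θ, ⟨a, b⟩, -⟩ := h.desc₂ k l σ.hom τ.hom
  obtain ⟨θ', ⟨a', b'⟩, -⟩ := h.desc₂ l k σ.inv τ.inv
  exact ⟨⟨θ, θ', h.hom_ext (by simp [a, a']) (by simp [b, b']),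
    h.hom_ext (by simp [a, a']) (by simp [b, b'])⟩, a, b⟩

/-- Replacing a summand of a bicoproduct by a pushout. -/
theorem pushout (h : IsBicoproduct i₀ i₁) {X' P : C}
    {f : X ⟶ X'} {p : X' ⟶ P} {q : S ⟶ P} {γ : f ≫ p ≅ i₀ ≫ q}
    (hγ : IsBipushout γ) : IsBicoproduct p (i₁ ≫ q) where
  desc f' g := by
    obtain ⟨s, ⟨a⟩, ⟨b⟩⟩ := h.desc (f ≫ f') g
    obtain ⟨k, σ, τ, -⟩ := hγ.desc f' s a.symm
    exact ⟨k, ⟨σ⟩, ⟨α_ _ _ _ ≪≫ whiskerLeftIso i₁ τ ≪≫ b⟩⟩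
  desc₂ k l σ τ := by
    -- The 2-cell on S is forced: σ transported through γ on the first summand, τ on the second.
    obtain ⟨θ, ⟨h₀, h₁⟩, -⟩ := h.desc₂ (q ≫ k) (q ≫ l)
      ((α_ _ _ _).inv ≫ γ.inv ▷ k ≫ (α_ _ _ _).hom ≫ f ◁ σ ≫ (α_ _ _ _).inv ≫ γ.hom ▷ l ≫
        (α_ _ _ _).hom) ((α_ _ _ _).inv ≫ τ ≫ (α_ _ _ _).hom)
    obtain ⟨ω, ⟨k₀, k₁⟩, hu⟩ := hγ.desc₂ k l σ θ (by simp [h₀])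
    refine ⟨ω, ⟨k₀, ?_⟩, fun ω' hω => hu ω' ⟨hω.1, h.hom_ext ?_ ?_⟩⟩
    · simp [k₁, h₁]
    · have e := whisker_exchange γ.hom ω'
      simp only [comp_whiskerLeft, Category.assoc, hω.1] at e
      rw [h₀, ← cancel_mono (α_ i₀ q l).inv]
      simp only [Category.assoc, Iso.hom_inv_id, Category.comp_id]
      rw [e]
      simp
    · rw [h₁, ← hω.2]
      simp

end IsBicoproduct

variable [ModelBicategory C]

theorem exists_isBicoproduct (X Y : C) :
    ∃ (S : C) (i₀ : X ⟶ S) (i₁ : Y ⟶ S), IsBicoproduct i₀ i₁ := by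
  obtain ⟨I, hI⟩ := exists_initial (C := C)
  obtain ⟨x⟩ := hI.exists_hom X
  obtain ⟨y⟩ := hI.exists_hom Y
  obtain ⟨S, i₀, i₁, γ, hγ⟩ := exists_pushout x y
  exact ⟨S, i₀, i₁, hγ.isBicoproduct hI⟩

/-- A trivial cofibration `i` induces a trivial cofibration of coproducts `i ⨿ i`. -/
theorem exists_trivial_cofibration_bicoproduct {A A' S : C} {i : A ⟶ A'} (hi : cof i)
    (hi' : weq i) {i₀ i₁ : A ⟶ S} (h : IsBicoproduct i₀ i₁) :
    ∃ (S' : C) (i₀' i₁' : A' ⟶ S') (j : S ⟶ S') (_ : i ≫ i₀' ≅ i₀ ≫ j) (_ : i ≫ i₁' ≅ i₁ ≫ j),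
      IsBicoproduct i₀' i₁' ∧ cof j ∧ weq j := by
  -- The summands are replaced one at a time, A ⨿ A ⟶ A' ⨿ A ⟶ A' ⨿ A', and each stage is a pushout
  -- of `i`.
  obtain ⟨P, p, q, γ, hγ⟩ := exists_pushout i i₀
  have h' := (h.pushout hγ).symm
  obtain ⟨P', p', q', γ', hγ'⟩ := exists_pushout i (i₁ ≫ q)
  have h'' := (h'.pushout hγ').symm
  have := cof_pushout γ hγ hi
  have := cof_pushout γ' hγ' hi
  have := weq_pushout γ hγ hi hi'
  have := weq_pushout γ' hγ' hi hi'
  exact ⟨P', p ≫ q', p', q ≫ q',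
    (α_ _ _ _).symm ≪≫ whiskerRightIso γ q' ≪≫ α_ _ _ _, γ' ≪≫ α_ _ _ _, h'',
    cof_comp _ _ ‹_› ‹_›, weq_comp (Iso.refl _) ‹_› ‹_›⟩

end Bicoproducts

/-! ### Lifting 2-cells through trivial fibrations to w-homotopies -/

section FibrationLifting

variable {C : Type u} [Bicategory.{w, v} C]

/-- The restriction of a filler along a leg `i` of the domain of `d`. -/
theorem Filler.leg {A S W Y B : C} {i : A ⟶ S} {d : S ⟶ W} {s : W ⟶ A} {p : Y ⟶ B} {a : S ⟶ Y}
    {t : A ⟶ B} {Γ : a ≫ p ≅ d ≫ s ≫ t} (φ : Filler Γ) {u : A ⟶ Y} (σ : i ≫ a ≅ u)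
    (ζ : u ≫ p ≅ t) (α₀ : (i ≫ d) ≫ s ≅ 𝟙 A)
    (h : i ◁ Γ.hom = ((α_ _ _ _).symm ≪≫ whiskerRightIso σ p ≪≫ ζ ≪≫ (λ_ t).symm ≪≫
      whiskerRightIso α₀.symm t ≪≫ α_ _ _ _ ≪≫ α_ _ _ _).hom) :
    (σ.inv ≫ i ◁ φ.lam.hom ≫ (α_ i d φ.f).inv) ▷ p ≫ (α_ _ _ _).hom ≫ (i ≫ d) ◁ φ.rho.hom ≫
      (α_ _ _ _).inv ≫ α₀.hom ▷ t = ζ.hom ≫ (λ_ t).inv := by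
  have h' := congrArg (i ◁ ·) φ.fac
  simp only [Bicategory.whiskerLeft_comp, h] at h'
  have h'' : i ◁ φ.lam.hom ▷ p ≫ i ◁ (α_ d φ.f p).hom ≫ i ◁ d ◁ φ.rho.hom ≫
      (α_ _ _ _).inv ≫ (α_ _ _ _).inv ≫ α₀.hom ▷ t = (α_ _ _ _).inv ≫ σ.hom ▷ p ≫ ζ.hom ≫
        (λ_ t).inv := by
    rw [reassoc_of% h']
    simp
  simp only [comp_whiskerRight, Bicategory.whisker_assoc, comp_whiskerLeft, Category.assoc]
  rw [← cancel_epi (σ.hom ▷ p), ← cancel_epi (α_ _ _ _).inv, ← h'']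
  simp

/-- The inverse form of `Filler.leg`, needed at the end of a homotopy, where the cell of the filler
is traversed backwards. -/
theorem Filler.leg_inv {A S W Y B : C} {i : A ⟶ S} {d : S ⟶ W} {s : W ⟶ A} {p : Y ⟶ B}
    {a : S ⟶ Y} {t : A ⟶ B} {Γ : a ≫ p ≅ d ≫ s ≫ t} (φ : Filler Γ) {u : A ⟶ Y} (σ : i ≫ a ≅ u)
    (ζ : u ≫ p ≅ t) (α₀ : (i ≫ d) ≫ s ≅ 𝟙 A)
    (h : i ◁ Γ.hom = ((α_ _ _ _).symm ≪≫ whiskerRightIso σ p ≪≫ ζ ≪≫ (λ_ t).symm ≪≫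
      whiskerRightIso α₀.symm t ≪≫ α_ _ _ _ ≪≫ α_ _ _ _).hom) :
    α₀.inv ▷ t ≫ (α_ _ _ _).hom ≫ (i ≫ d) ◁ φ.rho.inv ≫ (α_ _ _ _).inv ≫
      (σ.symm ≪≫ whiskerLeftIso i φ.lam ≪≫ (α_ i d φ.f).symm).inv ▷ p =
      (λ_ t).hom ≫ ζ.inv := by
  rw [← cancel_epi (ζ.hom ≫ (λ_ t).inv)]
  nth_rw 1 [← φ.leg σ ζ α₀ h]
  have : ((σ.inv ≫ i ◁ φ.lam.hom ≫ (α_ i d φ.f).inv) ▷ p) ≫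
      ((σ.symm ≪≫ whiskerLeftIso i φ.lam ≪≫ (α_ i d φ.f).symm).inv ▷ p) = 𝟙 _ := by
    rw [← Bicategory.comp_whiskerRight]
    simp
  simp only [Category.assoc, hom_inv_whiskerRight_assoc, Iso.inv_hom_id_assoc,
    whiskerLeft_hom_inv_assoc, Iso.hom_inv_id_assoc, this, Iso.hom_inv_id]

variable [ModelBicategory C]

/-- Factor the codiagonal A ⨿ A ⟶ A as a cofibration followed by a trivial fibration. -/
theorem exists_cylinder (A : C) : ∃ (S W : C) (i₀ i₁ : A ⟶ S) (d : S ⟶ W) (s : W ⟶ A)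
    (_ : (i₀ ≫ d) ≫ s ≅ 𝟙 A) (_ : (i₁ ≫ d) ≫ s ≅ 𝟙 A), IsBicoproduct i₀ i₁ ∧ cof d ∧ weq s := by
  obtain ⟨S, i₀, i₁, hS⟩ := exists_isBicoproduct A A
  obtain ⟨n, ⟨κ⟩, ⟨κ'⟩⟩ := hS.desc (𝟙 A) (𝟙 A)
  obtain ⟨W, d, s, hd, -, hs, ⟨e⟩⟩ := factor_right n
  exact ⟨S, W, i₀, i₁, d, s, α_ _ _ _ ≪≫ whiskerLeftIso i₀ e.symm ≪≫ κ,
    α_ _ _ _ ≪≫ whiskerLeftIso i₁ e.symm ≪≫ κ', hS, hd, hs⟩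

/-- An invertible 2-cell between composites with a trivial fibration lifts to a w-homotopy. -/
theorem exists_wHomotopy_whiskerRight {A Y B : C} {p : Y ⟶ B} (hp : fib p) (hp' : weq p)
    {u v : A ⟶ Y} (γ : u ≫ p ≅ v ≫ p) : ∃ H : WHomotopy u v, H.HasInvertibleCells ∧
      H.cls.{w₁, v₁, u₁}.whiskerRight p = HoCell.of γ.hom := by
  obtain ⟨S, W, i₀, i₁, d, s, α₀, α₁, hS, hd, hs⟩ := exists_cylinder A
  obtain ⟨a, ⟨σ⟩, ⟨τ⟩⟩ := hS.desc u v
  -- The bottom of the lifting square is W ⟶ A followed by `u ≫ p`. The square is thus trivial on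
  -- the first summand and carries the inverse of γ on the second.
  obtain ⟨Γ, h₀, h₁⟩ := hS.exists_iso (k := a ≫ p) (l := d ≫ s ≫ u ≫ p)
    ((α_ _ _ _).symm ≪≫ whiskerRightIso σ p ≪≫ Iso.refl _ ≪≫ (λ_ _).symm ≪≫
      whiskerRightIso α₀.symm _ ≪≫ α_ _ _ _ ≪≫ α_ _ _ _)
    ((α_ _ _ _).symm ≪≫ whiskerRightIso τ p ≪≫ γ.symm ≪≫ (λ_ _).symm ≪≫
      whiskerRightIso α₁.symm _ ≪≫ α_ _ _ _ ≪≫ α_ _ _ _)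
  obtain ⟨φ⟩ := (lifting d p hd hp (Or.inr hp')).lift Γ
  refine ⟨⟨⟨W, i₀ ≫ d, i₁ ≫ d, s, hs, α₀, α₁,
    ⟨S, i₀, i₁, d, hS, ⟨Iso.refl _⟩, ⟨Iso.refl _⟩, hd⟩⟩, φ.f,
      (σ.symm ≪≫ whiskerLeftIso i₀ φ.lam ≪≫ (α_ _ _ _).symm).hom,
      (τ.symm ≪≫ whiskerLeftIso i₁ φ.lam ≪≫ (α_ _ _ _).symm).inv⟩,
      ⟨inferInstance, inferInstance⟩, ?_⟩
  -- The filler's `rho` factors `φ.f ≫ p` through `s`. The first leg then contributes a unitor, the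
  -- second the inverse unitor followed by γ.
  refine (ofHomotopy_whiskerRight _ (t := u ≫ p) φ.rho).trans (congrArg HoCell.of ?_)
  have e₀ := φ.leg σ (Iso.refl _) α₀ h₀
  have e₁ := φ.leg_inv τ γ.symm α₁ h₁
  exact (congrArg₂ (· ≫ ·) e₀ e₁).trans (by simp)

end FibrationLifting

/-! ### Extending w-homotopies along trivial cofibrations -/

section CofibrationExtension

variable {C : Type u} [Bicategory.{w, v} C]

/-- The stability axioms speak of one leg of a pushout; this gives access to the other. -/
theorem IsBipushout.symm {P A B D : C} {f : D ⟶ A} {g : D ⟶ B} {p : A ⟶ P} {q : B ⟶ P}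
    {γ : f ≫ p ≅ g ≫ q} (h : IsBipushout γ) : IsBipushout γ.symm where
  desc a b δ := by
    obtain ⟨k, σ, τ, e⟩ := h.desc b a δ.symm
    refine ⟨k, τ, σ, ?_⟩
    rw [← cancel_mono δ.inv]
    simp only [Iso.symm_hom, Category.assoc, Iso.hom_inv_id, Category.comp_id] at e ⊢
    rw [e]
    simp
  desc₂ k l σ τ e := by
    obtain ⟨θ, ⟨a, b⟩, u⟩ := h.desc₂ k l τ σ (by
      have e' := congrArg (fun x => (α_ f p k).inv ≫ γ.hom ▷ k ≫ (α_ g q k).hom ≫ x ≫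
        (α_ f p l).inv ≫ γ.hom ▷ l ≫ (α_ g q l).hom) e
      simp at e'
      simp [e'])
    exact ⟨θ, ⟨b, a⟩, fun θ' hθ => u θ' ⟨hθ.2, hθ.1⟩⟩

/-- The comparison of the legs of two cylinders, one of them induced by a pushout. -/
def pushoutLegIso {A A' S S' W P : C} {i : A ⟶ A'} {l : A ⟶ S} {l' : A' ⟶ S'} {j : S ⟶ S'}
    (γ : i ≫ l' ≅ l ≫ j) {d : S ⟶ W} {d' : S' ⟶ P} {q : W ⟶ P} (Γ : j ≫ d' ≅ d ≫ q)
    {d₀ : A ⟶ W} (e : l ≫ d ≅ d₀) : i ≫ l' ≫ d' ≅ d₀ ≫ q :=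
  (α_ _ _ _).symm ≪≫ whiskerRightIso γ d' ≪≫ α_ _ _ _ ≪≫ whiskerLeftIso l Γ ≪≫
    (α_ _ _ _).symm ≪≫ whiskerRightIso e q

@[simp] theorem pushoutLegIso_hom {A A' S S' W P : C} {i : A ⟶ A'} {l : A ⟶ S} {l' : A' ⟶ S'}
    {j : S ⟶ S'} (γ : i ≫ l' ≅ l ≫ j) {d : S ⟶ W} {d' : S' ⟶ P} {q : W ⟶ P} (Γ : j ≫ d' ≅ d ≫ q)
    {d₀ : A ⟶ W} (e : l ≫ d ≅ d₀) : (pushoutLegIso γ Γ e).hom =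
      (α_ _ _ _).inv ≫ γ.hom ▷ d' ≫ (α_ _ _ _).hom ≫ l ◁ Γ.hom ≫ (α_ _ _ _).inv ≫ e.hom ▷ q :=
  rfl

/-- The pushout equation `fac` is restricted along the leg `l`, where `M` is known by `hM`;
interchange moves γ past σ and `e` past τ. -/
theorem pushoutLegIso_compat {A A' S S' W P T : C} {i : A ⟶ A'} {l : A ⟶ S} {l' : A' ⟶ S'}
    {j : S ⟶ S'} (γ : i ≫ l' ≅ l ≫ j) {d : S ⟶ W} {d' : S' ⟶ P} {q : W ⟶ P} (Γ : j ≫ d' ≅ d ≫ q)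
    {d₀ : A ⟶ W} (e : l ≫ d ≅ d₀) {k : P ⟶ T} {a : S' ⟶ T} {t : W ⟶ T} {u : A' ⟶ T}
    (σ : d' ≫ k ≅ a) (τ : q ≫ k ≅ t) (ω : l' ≫ a ≅ u) (ζ : d₀ ≫ t ≅ i ≫ u) {M : j ≫ a ≅ d ≫ t}
    (hM : l ◁ M.hom = ((α_ _ _ _).symm ≪≫ whiskerRightIso γ.symm a ≪≫ α_ _ _ _ ≪≫
      whiskerLeftIso i ω ≪≫ ζ.symm ≪≫ whiskerRightIso e.symm t ≪≫ α_ _ _ _).hom)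
    (fac : j ◁ σ.hom ≫ M.hom = (α_ _ _ _).inv ≫ Γ.hom ▷ k ≫ (α_ _ _ _).hom ≫ d ◁ τ.hom) :
    (pushoutLegIso γ Γ e).hom ▷ k ≫ (α_ _ _ _).hom ≫ d₀ ◁ τ.hom ≫ ζ.hom =
      (α_ _ _ _).hom ≫ i ◁ ((α_ _ _ _).hom ≫ l' ◁ σ.hom ≫ ω.hom) := by
  have h := congrArg (l ◁ ·) fac
  simp only [Bicategory.whiskerLeft_comp, hM] at h
  have h' : l ◁ Γ.hom ▷ k ≫ l ◁ (α_ _ _ _).hom ≫ l ◁ d ◁ τ.hom ≫ (α_ _ _ _).inv ≫ e.hom ▷ t ≫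
      ζ.hom = l ◁ (α_ _ _ _).hom ≫ l ◁ j ◁ σ.hom ≫ (α_ _ _ _).inv ≫ γ.inv ▷ a ≫ (α_ _ _ _).hom ≫
        i ◁ ω.hom := by
    rw [← cancel_epi (l ◁ (α_ _ _ _).inv)]
    have h'' := congrArg (fun x => x ≫ (α_ _ _ _).inv ≫ e.hom ▷ t ≫ ζ.hom) h
    simp only [Category.assoc] at h''
    rw [← h'']
    simp
  have x₁ := whisker_exchange γ.hom σ.hom
  simp only [comp_whiskerLeft, Category.assoc] at x₁
  have x₂ := whisker_exchange e.hom τ.hom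
  simp only [comp_whiskerLeft, Category.assoc] at x₂
  have x₁' : γ.hom ▷ (d' ≫ k) ≫ (α_ _ _ _).hom ≫ l ◁ j ◁ σ.hom ≫ (α_ _ _ _).inv ≫
      γ.inv ▷ a = (α_ _ _ _).hom ≫ i ◁ l' ◁ σ.hom ≫ (α_ _ _ _).inv := by
    rw [← reassoc_of% x₁]
    simp
  simp only [whiskerRight_comp, Category.assoc] at x₁'
  rw [← cancel_epi (α_ _ _ _).hom] at x₁'
  rw [← cancel_epi (α_ _ _ _).hom] at x₂
  simp only [whiskerRight_comp, Category.assoc, Iso.hom_inv_id_assoc] at x₁' x₂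
  simp only [pushoutLegIso_hom, comp_whiskerRight, Bicategory.whisker_assoc, Category.assoc]
  rw [← reassoc_of% x₂]
  have h₁ : (α_ l (j ≫ d') k).hom ≫ l ◁ Γ.hom ▷ k ≫ (α_ l (d ≫ q) k).inv ≫
      (α_ l d q).inv ▷ k ≫ (α_ (l ≫ d) q k).hom ≫ (α_ l d (q ≫ k)).hom ≫ l ◁ d ◁ τ.hom ≫
        (α_ l d t).inv ≫ e.hom ▷ t ≫ ζ.hom =
      (α_ l (j ≫ d') k).hom ≫ l ◁ (α_ j d' k).hom ≫ l ◁ j ◁ σ.hom ≫ (α_ l j a).inv ≫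
        γ.inv ▷ a ≫ (α_ i l' a).hom ≫ i ◁ ω.hom := by
    rw [← h']
    simp
  rw [h₁]
  have h₂ : (α_ l j d').hom ▷ k ≫ (α_ l (j ≫ d') k).hom ≫ l ◁ (α_ j d' k).hom =
      (α_ (l ≫ j) d' k).hom ≫ (α_ l j (d' ≫ k)).hom := by simp
  rw [reassoc_of% h₂, reassoc_of% x₁']
  simp

variable [ModelBicategory C]

/-- Every w-cylinder can be extended along a trivial cofibration. -/
theorem exists_wCylinder_extension {A A' : C} {i : A ⟶ A'} (hi : cof i) (hi' : weq i)
    (c : WCylinder A) : ∃ (c' : WCylinder A') (q : c.W ⟶ c'.W) (θ₀ : i ≫ c'.d₀ ≅ c.d₀ ≫ q)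
      (θ₁ : i ≫ c'.d₁ ≅ c.d₁ ≫ q),
      c'.toSigma.cell.{w₁, v₁, u₁}.whiskerLeft i =
        (HoCell.of θ₀.hom).comp ((c.toSigma.cell.whiskerRight q).comp (HoCell.of θ₁.inv)) ∧
      ∀ {T : C} (t : c.W ⟶ T) (u₀ u₁ : A' ⟶ T) (ζ₀ : c.d₀ ≫ t ≅ i ≫ u₀) (ζ₁ : c.d₁ ≫ t ≅ i ≫ u₁),
        ∃ (k : c'.W ⟶ T) (τ : q ≫ k ≅ t) (ω₀ : c'.d₀ ≫ k ≅ u₀) (ω₁ : c'.d₁ ≫ k ≅ u₁),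
          θ₀.hom ▷ k ≫ (α_ _ _ _).hom ≫ c.d₀ ◁ τ.hom ≫ ζ₀.hom = (α_ _ _ _).hom ≫ i ◁ ω₀.hom ∧
          θ₁.hom ▷ k ≫ (α_ _ _ _).hom ≫ c.d₁ ◁ τ.hom ≫ ζ₁.hom = (α_ _ _ _).hom ≫ i ◁ ω₁.hom := by
  obtain ⟨W, d₀, d₁, s, hs, α₀, α₁, S, l₀, l₁, d, hS, ⟨e₀⟩, ⟨e₁⟩, hd⟩ := c
  obtain ⟨S', l₀', l₁', j, γ₀, γ₁, hS', hj, hj'⟩ :=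
    exists_trivial_cofibration_bicoproduct hi hi' hS
  -- The new cylinder is the pushout of W along A ⨿ A ⟶ A' ⨿ A'. Its two legs are a cofibration out
  -- of A' ⨿ A' and a weak equivalence out of W.
  obtain ⟨P, d', q, Γ, hΓ⟩ := exists_pushout j d
  have hd' : cof d' := cof_pushout _ hΓ.symm hd
  have hq : weq q := weq_pushout _ hΓ hj hj'
  -- The universal property of P in terms of cylinder ends. It serves twice: for the projection `s'`
  -- and for the extension of arbitrary homotopies.
  have key : ∀ {T : C} (t : W ⟶ T) (u₀ u₁ : A' ⟶ T) (ζ₀ : d₀ ≫ t ≅ i ≫ u₀)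
      (ζ₁ : d₁ ≫ t ≅ i ≫ u₁), ∃ (k : P ⟶ T) (τ : q ≫ k ≅ t) (ω₀ : (l₀' ≫ d') ≫ k ≅ u₀)
        (ω₁ : (l₁' ≫ d') ≫ k ≅ u₁),
        (pushoutLegIso γ₀ Γ e₀).hom ▷ k ≫ (α_ _ _ _).hom ≫ d₀ ◁ τ.hom ≫ ζ₀.hom =
          (α_ _ _ _).hom ≫ i ◁ ω₀.hom ∧
        (pushoutLegIso γ₁ Γ e₁).hom ▷ k ≫ (α_ _ _ _).hom ≫ d₁ ◁ τ.hom ≫ ζ₁.hom =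
          (α_ _ _ _).hom ≫ i ◁ ω₁.hom := by
    intro T t u₀ u₁ ζ₀ ζ₁
    obtain ⟨a, ⟨ω₀⟩, ⟨ω₁⟩⟩ := hS'.desc u₀ u₁
    -- The comparison over A ⨿ A is glued from ζ₀ and ζ₁ on the two summands.
    obtain ⟨M, hM₀, hM₁⟩ := hS.exists_iso (k := j ≫ a) (l := d ≫ t)
      ((α_ _ _ _).symm ≪≫ whiskerRightIso γ₀.symm a ≪≫ α_ _ _ _ ≪≫ whiskerLeftIso i ω₀ ≪≫
        ζ₀.symm ≪≫ whiskerRightIso e₀.symm t ≪≫ α_ _ _ _)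
      ((α_ _ _ _).symm ≪≫ whiskerRightIso γ₁.symm a ≪≫ α_ _ _ _ ≪≫ whiskerLeftIso i ω₁ ≪≫
        ζ₁.symm ≪≫ whiskerRightIso e₁.symm t ≪≫ α_ _ _ _)
    obtain ⟨k, σ, τ, fac⟩ := hΓ.desc a t M
    exact ⟨k, τ, α_ _ _ _ ≪≫ whiskerLeftIso l₀' σ ≪≫ ω₀, α_ _ _ _ ≪≫ whiskerLeftIso l₁' σ ≪≫ ω₁,
      pushoutLegIso_compat γ₀ Γ e₀ σ τ ω₀ ζ₀ hM₀ fac,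
      pushoutLegIso_compat γ₁ Γ e₁ σ τ ω₁ ζ₁ hM₁ fac⟩
  -- The projection of P to A' is `s ≫ i` on W and the codiagonal on A' ⨿ A'.
  obtain ⟨s', ψ, α₀', α₁', h₀, h₁⟩ := key (s ≫ i) (𝟙 A') (𝟙 A')
    ((α_ _ _ _).symm ≪≫ whiskerRightIso α₀ i ≪≫ λ_ i ≪≫ (ρ_ i).symm)
    ((α_ _ _ _).symm ≪≫ whiskerRightIso α₁ i ≪≫ λ_ i ≪≫ (ρ_ i).symm)
  -- Two out of three: `q` and `s ≫ i` are weak equivalences.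
  have hs' : weq s' := weq_right ψ hq (weq_comp (Iso.refl _) hs hi')
  exact ⟨⟨P, l₀' ≫ d', l₁' ≫ d', s', hs', α₀', α₁', S', l₀', l₁', d', hS', ⟨Iso.refl _⟩,
    ⟨Iso.refl _⟩, hd'⟩, q, pushoutLegIso γ₀ Γ e₀, pushoutLegIso γ₁ Γ e₁,
    cell_whiskerLeft (i := i) (c := ⟨W, A, d₀, d₁, 𝟙 A, s, hs, α₀, α₁⟩)
      (c' := ⟨P, A', l₀' ≫ d', l₁' ≫ d', 𝟙 A', s', hs', α₀', α₁'⟩) (k := i) _ _ ψ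
      (λ_ i ≪≫ (ρ_ i).symm) h₀ h₁, key⟩

/-- Composing with 2-cells of `C` at the ends can be absorbed into `eta` and `eps`. -/
theorem ofHomotopy_comp {X Y : C} {f f' g g' : X ⟶ Y} (H : SigmaHomotopy f g) (μ : f' ⟶ f)
    (ν : g ⟶ g') : HoCell.ofHomotopy.{w₁, v₁, u₁} ⟨H.cyl, H.h, μ ≫ H.eta, H.eps ≫ ν⟩ =
      (HoCell.of μ).comp ((HoCell.ofHomotopy H).comp (HoCell.of ν)) := by
  rw [ofHomotopy_eq, ofHomotopy_eq, ← HoCell.of_comp, ← HoCell.of_comp]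
  simp only [HoCell.assoc]

/-- A w-homotopy between restrictions along a trivial cofibration extends. -/
theorem exists_wHomotopy_whiskerLeft {A A' B : C} {i : A ⟶ A'} (hi : cof i) (hi' : weq i)
    {f g : A ⟶ B} (H : WHomotopy f g) (hH : H.HasInvertibleCells) {u v : A' ⟶ B}
    (μ : i ≫ u ≅ f) (ν : g ≅ i ≫ v) : ∃ K : WHomotopy u v, K.HasInvertibleCells ∧
      K.cls.{w₁, v₁, u₁}.whiskerLeft i =
        (HoCell.of μ.hom).comp (H.cls.comp (HoCell.of ν.hom)) := by
  obtain ⟨c, h, eta, eps⟩ := H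
  obtain ⟨h_eta, h_eps⟩ := hH
  dsimp only at h_eta h_eps
  obtain ⟨c', q, θ₀, θ₁, hc, hk⟩ := exists_wCylinder_extension.{w₁, v₁, u₁} hi hi' c
  -- Gluing needs invertible comparisons, so `eta` and `eps` must be invertible here. In return the
  -- new end cells ω₀ and ω₁ are invertible by construction.
  obtain ⟨k, τ, ω₀, ω₁, h₀, h₁⟩ := hk h u v ((asIso eta).symm ≪≫ μ.symm) (asIso eps ≪≫ ν)
  refine ⟨⟨c', k, ω₀.inv, ω₁.hom⟩, ⟨inferInstance, inferInstance⟩, ?_⟩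
  have e₀ : i ◁ ω₀.inv ≫ (α_ _ _ _).inv ≫ θ₀.hom ▷ k ≫ (α_ _ _ _).hom ≫ c.d₀ ◁ τ.hom =
      μ.hom ≫ eta := by
    rw [← cancel_mono ((asIso eta).symm ≪≫ μ.symm).hom]
    simp only [Category.assoc, h₀]
    simp
  have e₁ : c.d₁ ◁ τ.inv ≫ (α_ _ _ _).inv ≫ θ₁.inv ▷ k ≫ (α_ _ _ _).hom ≫ i ◁ ω₁.hom =
      eps ≫ ν.hom := by
    rw [← h₁]
    simp
  have h₂ := ofHomotopy_whiskerLeft (c := c.toSigma) (c' := c'.toSigma) θ₀ θ₁ hc τ ω₀.inv ω₁.hom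
  exact (h₂.trans (congrArg₂ (fun x y => HoCell.ofHomotopy ⟨c.toSigma, h, x, y⟩) e₀ e₁)).trans
    (ofHomotopy_comp ⟨c.toSigma, h, eta, eps⟩ μ.hom ν.hom)

end CofibrationExtension

/-! ### Existence of normalized replacements -/

section ReplacementExistence

variable {C : Type u} [Bicategory.{w, v} C]

/-- Naturality of the unitors, in the shape of the condition on `Q.map₂` when p is an identity. -/
theorem whiskerRight_id_eq {X Y : C} {f g : X ⟶ Y} (μ : f ⟶ g) : μ ▷ 𝟙 Y =
    (ρ_ f ≪≫ (λ_ f).symm).hom ≫ 𝟙 X ◁ μ ≫ (ρ_ g ≪≫ (λ_ g).symm).inv := by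
  simp

theorem id_whiskerLeft_eq {X Y : C} {f g : X ⟶ Y} (μ : f ⟶ g) : 𝟙 X ◁ μ =
    (ρ_ f ≪≫ (λ_ f).symm).inv ≫ μ ▷ 𝟙 Y ≫ (ρ_ g ≪≫ (λ_ g).symm).hom := by
  simp

variable [ModelBicategory C]

/-- Lift `p` against 0 ⟶ A; the square to be filled exists because arrows out of 0 are isomorphic.
-/
theorem IsCofibrant.exists_lift {A Y B : C} (hA : IsCofibrant A) {p : Y ⟶ B} (hp : fib p)
    (hp' : weq p) (b : A ⟶ B) : ∃ f : A ⟶ Y, Nonempty (f ≫ p ≅ b) := by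
  obtain ⟨I, hI, t, ht⟩ := hA
  obtain ⟨a⟩ := hI.exists_hom Y
  obtain ⟨γ⟩ := hI.exists_iso (a ≫ p) (t ≫ b)
  obtain ⟨φ⟩ := (lifting t p ht hp (Or.inr hp')).lift γ
  exact ⟨φ.f, ⟨φ.rho⟩⟩

/-- The arrows `u` and `v` fill their own squares, and the compatibility required by the
two-dimensional lifting property is an equation between 2-cells out of 0. -/
theorem IsCofibrant.exists_lift₂ {A Y B : C} (hA : IsCofibrant A) {p : Y ⟶ B} (hp : fib p)
    (hp' : weq p) {u v : A ⟶ Y} (β : u ≫ p ⟶ v ≫ p) : ∃ δ : u ⟶ v, δ ▷ p = β := by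
  obtain ⟨I, hI, t, ht⟩ := hA
  obtain ⟨a⟩ := hI.exists_iso (t ≫ u) (t ≫ v)
  obtain ⟨δ, -, h⟩ := (lifting t p ht hp (Or.inr hp')).lift₂ (α_ t u p) (α_ t v p)
    ⟨u, Iso.refl _, Iso.refl _, by simp⟩ ⟨v, Iso.refl _, Iso.refl _, by simp⟩ a.hom β
    (hI.hom_ext _ _)
  exact ⟨δ, by simpa using h⟩

/-- Dual to `IsCofibrant.exists_lift`, with A' ⟶ * in place of 0 ⟶ A. -/
theorem IsFibrant.exists_extension {A A' B : C} (hB : IsFibrant B) {i : A ⟶ A'} (hi : cof i)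
    (hi' : weq i) (a : A ⟶ B) : ∃ f : A' ⟶ B, Nonempty (a ≅ i ≫ f) := by
  obtain ⟨T, hT, t, ht⟩ := hB
  obtain ⟨b⟩ := hT.exists_hom A'
  obtain ⟨γ⟩ := hT.exists_iso (a ≫ t) (i ≫ b)
  obtain ⟨φ⟩ := (lifting i t hi ht (Or.inl hi')).lift γ
  exact ⟨φ.f, ⟨φ.lam⟩⟩

theorem IsFibrant.exists_extension₂ {A A' B : C} (hB : IsFibrant B) {i : A ⟶ A'} (hi : cof i)
    (hi' : weq i) {u v : A' ⟶ B} (β : i ≫ u ⟶ i ≫ v) : ∃ δ : u ⟶ v, i ◁ δ = β := by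
  obtain ⟨T, hT, t, ht⟩ := hB
  obtain ⟨b⟩ := hT.exists_iso (u ≫ t) (v ≫ t)
  obtain ⟨δ, h, -⟩ := (lifting i t hi ht (Or.inl hi')).lift₂ (α_ i u t) (α_ i v t)
    ⟨u, Iso.refl _, Iso.refl _, by simp⟩ ⟨v, Iso.refl _, Iso.refl _, by simp⟩ β b.hom
    (hT.hom_ext _ _)
  exact ⟨δ, by simpa using h.symm⟩

/-- A cofibrant object with a trivial fibration to `X`. -/
structure CofibrantApproximation (X : C) where
  obj : C
  p : obj ⟶ X
  cofibrant : IsCofibrant obj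
  fib_p : fib p
  weq_p : weq p

/-- A fibrant object with a trivial cofibration from `X`. -/
structure FibrantApproximation (X : C) where
  obj : C
  i : X ⟶ obj
  fibrant : IsFibrant obj
  cof_i : cof i
  weq_i : weq i

namespace CofibrantApproximation

/-- A cofibrant object approximates itself. -/
def refl (X : C) (hX : IsCofibrant X) : CofibrantApproximation X where
  obj := X
  p := 𝟙 X
  cofibrant := hX
  fib_p := fib_of_equivalence _ (isEquivalence_id X)
  weq_p := weq_id X

/-- Normalization is one equation between bundled approximations, so that object and projection can
later be substituted together. -/
theorem exists_normalized (X : C) :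
    ∃ c : CofibrantApproximation X, ∀ hX : IsCofibrant X, c = refl X hX := by
  by_cases hX : IsCofibrant X
  · exact ⟨refl X hX, fun _ => rfl⟩
  · obtain ⟨I, hI⟩ := exists_initial (C := C)
    obtain ⟨x⟩ := hI.exists_hom X
    obtain ⟨Z, i, p, hi, hp, hp', -⟩ := factor_right x
    exact ⟨⟨Z, p, ⟨I, hI, i, hi⟩, hp, hp'⟩, fun h => absurd h hX⟩

/-- An arrow between cofibrant approximations. -/
structure Map {X Y : C} (c : CofibrantApproximation X) (c' : CofibrantApproximation Y)
    (f : X ⟶ Y) where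
  map : c.obj ⟶ c'.obj
  rho : map ≫ c'.p ≅ c.p ≫ f

/-- The arrow `m` is `f` itself if `X` and `Y` are cofibrant. -/
def Map.IsNormalized {X Y : C} {c : CofibrantApproximation X} {c' : CofibrantApproximation Y}
    {f : X ⟶ Y} (m : Map c c' f) : Prop :=
  IsCofibrant X → IsCofibrant Y → m.map ≍ f ∧ m.rho ≍ ρ_ f ≪≫ (λ_ f).symm

theorem exists_map {X Y : C} (c : CofibrantApproximation X) (c' : CofibrantApproximation Y)
    (hc : ∀ hX : IsCofibrant X, c = refl X hX) (hc' : ∀ hY : IsCofibrant Y, c' = refl Y hY)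
    (f : X ⟶ Y) : ∃ m : Map c c' f, m.IsNormalized := by
  by_cases h : IsCofibrant X ∧ IsCofibrant Y
  · obtain rfl := hc h.1
    obtain rfl := hc' h.2
    exact ⟨⟨f, ρ_ f ≪≫ (λ_ f).symm⟩, fun _ _ => ⟨HEq.rfl, HEq.rfl⟩⟩
  · obtain ⟨m, ⟨r⟩⟩ := c.cofibrant.exists_lift c'.fib_p c'.weq_p (c.p ≫ f)
    exact ⟨⟨m, r⟩, fun h₀ h₁ => absurd ⟨h₀, h₁⟩ h⟩

/-- If both objects are cofibrant, everything becomes the identity choice and `μ` itself works by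
`whiskerRight_id_eq`; otherwise the 2-cell is lifted through the trivial fibration. -/
theorem exists_map₂ {X Y : C} {c : CofibrantApproximation X} {c' : CofibrantApproximation Y}
    (hc : ∀ hX : IsCofibrant X, c = refl X hX) (hc' : ∀ hY : IsCofibrant Y, c' = refl Y hY)
    {f g : X ⟶ Y} (μ : f ⟶ g) {m : Map c c' f} (hm : m.IsNormalized) {m' : Map c c' g}
    (hm' : m'.IsNormalized) : ∃ τ : m.map ⟶ m'.map,
      τ ▷ c'.p = m.rho.hom ≫ c.p ◁ μ ≫ m'.rho.inv ∧
      (IsCofibrant X → IsCofibrant Y → τ ≍ μ) := by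
  by_cases h : IsCofibrant X ∧ IsCofibrant Y
  · obtain rfl := hc h.1
    obtain rfl := hc' h.2
    obtain ⟨m, r⟩ := m
    obtain ⟨m', r'⟩ := m'
    obtain ⟨e, e'⟩ := hm h.1 h.2
    obtain ⟨k, k'⟩ := hm' h.1 h.2
    obtain rfl : m = f := eq_of_heq e
    obtain rfl : m' = g := eq_of_heq k
    obtain rfl := eq_of_heq e'
    obtain rfl := eq_of_heq k'
    exact ⟨μ, whiskerRight_id_eq μ, fun _ _ => HEq.rfl⟩
  · obtain ⟨τ, hτ⟩ := c.cofibrant.exists_lift₂ c'.fib_p c'.weq_p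
      (m.rho.hom ≫ c.p ◁ μ ≫ m'.rho.inv)
    exact ⟨τ, hτ, fun h₀ h₁ => absurd ⟨h₀, h₁⟩ h⟩

end CofibrantApproximation

namespace FibrantApproximation

/-- A fibrant object approximates itself. -/
def refl (X : C) (hX : IsFibrant X) : FibrantApproximation X where
  obj := X
  i := 𝟙 X
  fibrant := hX
  cof_i := cof_of_equivalence _ (isEquivalence_id X)
  weq_i := weq_id X

theorem exists_normalized (X : C) :
    ∃ c : FibrantApproximation X, ∀ hX : IsFibrant X, c = refl X hX := by
  by_cases hX : IsFibrant X
  · exact ⟨refl X hX, fun _ => rfl⟩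
  · obtain ⟨T, hT⟩ := exists_terminal (C := C)
    obtain ⟨x⟩ := hT.exists_hom X
    obtain ⟨Z, i, p, hi, hi', hp, -⟩ := factor_left x
    exact ⟨⟨Z, i, ⟨T, hT, p, hp⟩, hi, hi'⟩, fun h => absurd h hX⟩

/-- An arrow between fibrant approximations. -/
structure Map {X Y : C} (c : FibrantApproximation X) (c' : FibrantApproximation Y)
    (f : X ⟶ Y) where
  map : c.obj ⟶ c'.obj
  lam : f ≫ c'.i ≅ c.i ≫ map

/-- The arrow `m` is `f` itself if `X` and `Y` are fibrant. -/
def Map.IsNormalized {X Y : C} {c : FibrantApproximation X} {c' : FibrantApproximation Y}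
    {f : X ⟶ Y} (m : Map c c' f) : Prop :=
  IsFibrant X → IsFibrant Y → m.map ≍ f ∧ m.lam ≍ ρ_ f ≪≫ (λ_ f).symm

theorem exists_map {X Y : C} (c : FibrantApproximation X) (c' : FibrantApproximation Y)
    (hc : ∀ hX : IsFibrant X, c = refl X hX) (hc' : ∀ hY : IsFibrant Y, c' = refl Y hY)
    (f : X ⟶ Y) : ∃ m : Map c c' f, m.IsNormalized := by
  by_cases h : IsFibrant X ∧ IsFibrant Y
  · obtain rfl := hc h.1
    obtain rfl := hc' h.2
    exact ⟨⟨f, ρ_ f ≪≫ (λ_ f).symm⟩, fun _ _ => ⟨HEq.rfl, HEq.rfl⟩⟩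
  · obtain ⟨m, ⟨r⟩⟩ := c'.fibrant.exists_extension c.cof_i c.weq_i (f ≫ c'.i)
    exact ⟨⟨m, r⟩, fun h₀ h₁ => absurd ⟨h₀, h₁⟩ h⟩

theorem exists_map₂ {X Y : C} {c : FibrantApproximation X} {c' : FibrantApproximation Y}
    (hc : ∀ hX : IsFibrant X, c = refl X hX) (hc' : ∀ hY : IsFibrant Y, c' = refl Y hY)
    {f g : X ⟶ Y} (μ : f ⟶ g) {m : Map c c' f} (hm : m.IsNormalized) {m' : Map c c' g}
    (hm' : m'.IsNormalized) : ∃ τ : m.map ⟶ m'.map,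
      c.i ◁ τ = m.lam.inv ≫ μ ▷ c'.i ≫ m'.lam.hom ∧
      (IsFibrant X → IsFibrant Y → τ ≍ μ) := by
  by_cases h : IsFibrant X ∧ IsFibrant Y
  · obtain rfl := hc h.1
    obtain rfl := hc' h.2
    obtain ⟨m, r⟩ := m
    obtain ⟨m', r'⟩ := m'
    obtain ⟨e, e'⟩ := hm h.1 h.2
    obtain ⟨k, k'⟩ := hm' h.1 h.2
    obtain rfl : m = f := eq_of_heq e
    obtain rfl : m' = g := eq_of_heq k
    obtain rfl := eq_of_heq e'
    obtain rfl := eq_of_heq k'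
    exact ⟨μ, id_whiskerLeft_eq μ, fun _ _ => HEq.rfl⟩
  · obtain ⟨τ, hτ⟩ := c'.fibrant.exists_extension₂ c.cof_i c.weq_i
      (m.lam.inv ≫ μ ▷ c'.i ≫ m'.lam.hom)
    exact ⟨τ, hτ, fun h₀ h₁ => absurd ⟨h₀, h₁⟩ h⟩

end FibrantApproximation

-- Objects, arrows and 2-cells are chosen in turn, each choice depending on the normalization of the
-- earlier ones.
variable (C) in
theorem exists_cofibrantReplacement : ∃ Q : CofibrantReplacement C, Q.IsNormalized := by
  choose c hc using CofibrantApproximation.exists_normalized (C := C)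
  choose m hm using fun {X Y : C} (f : X ⟶ Y) =>
    CofibrantApproximation.exists_map (c X) (c Y) (hc X) (hc Y) f
  choose τ hτ hτ' using fun {X Y : C} {f g : X ⟶ Y} (μ : f ⟶ g) =>
    CofibrantApproximation.exists_map₂ (hc X) (hc Y) μ (hm f) (hm g)
  refine ⟨⟨fun X => (c X).obj, fun X => (c X).p, fun X => (c X).cofibrant, fun X => (c X).fib_p,
    fun X => (c X).weq_p, fun f => (m f).map, fun f => (m f).rho, fun μ => τ μ, fun μ => hτ μ⟩,
    fun X hX => congrArg CofibrantApproximation.obj (hc X hX), fun X hX => ?_,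
    fun f hX hY => (hm f hX hY).1, fun f hX hY => (hm f hX hY).2,
    fun μ hX hY => hτ' μ hX hY⟩
  dsimp only
  rw [hc X hX]
  rfl

variable (C) in
theorem exists_fibrantReplacement : ∃ R : FibrantReplacement C, R.IsNormalized := by
  choose c hc using FibrantApproximation.exists_normalized (C := C)
  choose m hm using fun {X Y : C} (f : X ⟶ Y) =>
    FibrantApproximation.exists_map (c X) (c Y) (hc X) (hc Y) f
  choose τ hτ hτ' using fun {X Y : C} {f g : X ⟶ Y} (μ : f ⟶ g) =>
    FibrantApproximation.exists_map₂ (hc X) (hc Y) μ (hm f) (hm g)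
  refine ⟨⟨fun X => (c X).obj, fun X => (c X).i, fun X => (c X).fibrant, fun X => (c X).cof_i,
    fun X => (c X).weq_i, fun f => (m f).map, fun f => (m f).lam, fun μ => τ μ, fun μ => hτ μ⟩,
    fun X hX => congrArg FibrantApproximation.obj (hc X hX), fun X hX => ?_,
    fun f hX hY => (hm f hX hY).1, fun f hX hY => (hm f hX hY).2,
    fun μ hX hY => hτ' μ hX hY⟩
  dsimp only
  rw [hc X hX]
  rfl

end ReplacementExistence

/-! ### Pairs of squares with a common top row -/

section IteratedSquares

variable {B : Type u} [Bicategory.{w, v} B]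

variable {X X' X'' Y Y' Y'' Z Z' Z'' T T₁ T₂ : B} {a : X ⟶ X'} {b : Y ⟶ Y'} {c : Z ⟶ Z'}
  {d : T ⟶ T₁} {a' : X ⟶ X''} {b' : Y ⟶ Y''} {c' : Z ⟶ Z''} {d' : T ⟶ T₂}

/-- The 2-cells `υ` and `τ` are related through some 2-cell compatible with both of them. -/
def CompatSpan {m₁ m₂ : X ⟶ Y} {n₁ n₂ : X' ⟶ Y'} {l₁ l₂ : X'' ⟶ Y''}
    (s : m₁ ≫ b ≅ a ≫ n₁) (s' : m₁ ≫ b' ≅ a' ≫ l₁) (t : m₂ ≫ b ≅ a ≫ n₂)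
    (t' : m₂ ≫ b' ≅ a' ≫ l₂) (τ : n₁ ⟶ n₂) (υ : l₁ ⟶ l₂) : Prop :=
  ∃ κ : m₁ ⟶ m₂, Compat s t κ τ ∧ Compat s' t' κ υ

namespace CompatSpan

variable {m₁ m₂ m₃ : X ⟶ Y} {n₁ n₂ n₃ : X' ⟶ Y'} {l₁ l₂ l₃ : X'' ⟶ Y''}
    {s : m₁ ≫ b ≅ a ≫ n₁} {s' : m₁ ≫ b' ≅ a' ≫ l₁} {t : m₂ ≫ b ≅ a ≫ n₂}
    {t' : m₂ ≫ b' ≅ a' ≫ l₂} {q : m₃ ≫ b ≅ a ≫ n₃} {q' : m₃ ≫ b' ≅ a' ≫ l₃}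

theorem refl (s : m₁ ≫ b ≅ a ≫ n₁) (s' : m₁ ≫ b' ≅ a' ≫ l₁) :
    CompatSpan s s' s s' (𝟙 _) (𝟙 _) :=
  ⟨𝟙 _, Compat.refl s, Compat.refl s'⟩

theorem trans {τ : n₁ ⟶ n₂} {υ : l₁ ⟶ l₂} {τ' : n₂ ⟶ n₃} {υ' : l₂ ⟶ l₃}
    (h : CompatSpan s s' t t' τ υ) (h' : CompatSpan t t' q q' τ' υ') :
    CompatSpan s s' q q' (τ ≫ τ') (υ ≫ υ') := by
  obtain ⟨κ, h₀, h₁⟩ := h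
  obtain ⟨κ', h₀', h₁'⟩ := h'
  exact ⟨κ ≫ κ', h₀.trans h₀', h₁.trans h₁'⟩

theorem whiskerLeft {m : T ⟶ X} {n : T₁ ⟶ X'} {l : T₂ ⟶ X''} (r : m ≫ a ≅ d ≫ n)
    (r' : m ≫ a' ≅ d' ≫ l) {τ : n₁ ⟶ n₂} {υ : l₁ ⟶ l₂} (h : CompatSpan s s' t t' τ υ) :
    CompatSpan (squareComp r s) (squareComp r' s') (squareComp r t) (squareComp r' t')
      (n ◁ τ) (l ◁ υ) := by
  obtain ⟨κ, h₀, h₁⟩ := h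
  exact ⟨m ◁ κ, h₀.whiskerLeft r, h₁.whiskerLeft r'⟩

theorem whiskerRight {τ : n₁ ⟶ n₂} {υ : l₁ ⟶ l₂} (h : CompatSpan s s' t t' τ υ)
    {m : Y ⟶ Z} {n : Y' ⟶ Z'} {l : Y'' ⟶ Z''} (r : m ≫ c ≅ b ≫ n) (r' : m ≫ c' ≅ b' ≫ l) :
    CompatSpan (squareComp s r) (squareComp s' r') (squareComp t r) (squareComp t' r')
      (τ ▷ n) (υ ▷ l) := by
  obtain ⟨κ, h₀, h₁⟩ := h
  exact ⟨κ ▷ m, h₀.whiskerRight r, h₁.whiskerRight r'⟩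

theorem associator {m : X ⟶ Y} {n : X' ⟶ Y'} {l : X'' ⟶ Y''} {m' : Y ⟶ Z} {n' : Y' ⟶ Z'}
    {l' : Y'' ⟶ Z''} {m'' : Z ⟶ T} {n'' : Z' ⟶ T₁} {l'' : Z'' ⟶ T₂}
    (s : m ≫ b ≅ a ≫ n) (s' : m ≫ b' ≅ a' ≫ l) (t : m' ≫ c ≅ b ≫ n') (t' : m' ≫ c' ≅ b' ≫ l')
    (q : m'' ≫ d ≅ c ≫ n'') (q' : m'' ≫ d' ≅ c' ≫ l'') :
    CompatSpan (squareComp (squareComp s t) q) (squareComp (squareComp s' t') q')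
      (squareComp s (squareComp t q)) (squareComp s' (squareComp t' q'))
      (α_ _ _ _).hom (α_ _ _ _).hom :=
  ⟨_, Compat.associator s t q, Compat.associator s' t' q'⟩

theorem leftUnitor (s : m₁ ≫ b ≅ a ≫ n₁) (s' : m₁ ≫ b' ≅ a' ≫ l₁) :
    CompatSpan (squareComp (squareId a) s) (squareComp (squareId a') s') s s'
      (λ_ _).hom (λ_ _).hom :=
  ⟨_, Compat.leftUnitor s, Compat.leftUnitor s'⟩

theorem rightUnitor (s : m₁ ≫ b ≅ a ≫ n₁) (s' : m₁ ≫ b' ≅ a' ≫ l₁) :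
    CompatSpan (squareComp s (squareId b)) (squareComp s' (squareId b')) s s'
      (ρ_ _).hom (ρ_ _).hom :=
  ⟨_, Compat.rightUnitor s, Compat.rightUnitor s'⟩

/-- The 2-cell τ determines the middle 2-cell κ, and κ determines υ. This is the mechanism behind
all pseudofunctor axioms. -/
theorem unique {τ τ' : n₁ ⟶ n₂} {υ υ' : l₁ ⟶ l₂} (h : CompatSpan s s' t t' τ υ)
    (h' : CompatSpan s s' t t' τ' υ')
    (hb : ∀ κ κ' : m₁ ⟶ m₂, κ ▷ b = κ' ▷ b → κ = κ')
    (ha : ∀ υ υ' : l₁ ⟶ l₂, a' ◁ υ = a' ◁ υ' → υ = υ') (hτ : τ = τ') : υ = υ' := by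
  obtain ⟨κ, h₀, h₁⟩ := h
  obtain ⟨κ', h₀', h₁'⟩ := h'
  subst hτ
  obtain rfl := Compat.top_unique hb h₀ h₀'
  exact Compat.bot_unique ha h₁ h₁'

end CompatSpan

/-- 2-cells related as in `CompatSpan`, through an invertible 2-cell. -/
theorem compatSpan_inv {m₁ m₂ : X ⟶ Y} {n₁ n₂ : X' ⟶ Y'} {l₁ l₂ : X'' ⟶ Y''}
    {s : m₁ ≫ b ≅ a ≫ n₁} {s' : m₁ ≫ b' ≅ a' ≫ l₁} {t : m₂ ≫ b ≅ a ≫ n₂}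
    {t' : m₂ ≫ b' ≅ a' ≫ l₂} {κ : m₁ ≅ m₂} {τ : n₁ ≅ n₂} {υ : l₁ ≅ l₂}
    (h : Compat s t κ.hom τ.hom) (h' : Compat s' t' κ.hom υ.hom) :
    CompatSpan t t' s s' τ.inv υ.inv :=
  ⟨κ.inv, h.symm, h'.symm⟩

end IteratedSquares

/-! ### The w-homotopies for identities and composites -/

section StructuralHomotopies

variable {C : Type u} [Bicategory.{w, v} C] [ModelBicategory C]

/-- The composite of a w-homotopy and an arrow. -/
def WHomotopy.whiskerRight {X Y Y' : C} {f g : X ⟶ Y} (H : WHomotopy f g) (r : Y ⟶ Y') :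
    WHomotopy (f ≫ r) (g ≫ r) where
  cyl := H.cyl
  h := H.h ≫ r
  eta := H.eta ▷ r ≫ (α_ _ _ _).hom
  eps := (α_ _ _ _).inv ≫ H.eps ▷ r

theorem WHomotopy.HasInvertibleCells.whiskerRight {X Y Y' : C} {f g : X ⟶ Y} {H : WHomotopy f g}
    (hH : H.HasInvertibleCells) (r : Y ⟶ Y') : (H.whiskerRight r).HasInvertibleCells := by
  obtain ⟨_, _⟩ := hH
  exact ⟨inferInstanceAs (IsIso (H.eta ▷ r ≫ (α_ _ _ _).hom)),
    inferInstanceAs (IsIso ((α_ _ _ _).inv ≫ H.eps ▷ r))⟩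

variable (Q : CofibrantReplacement C) (R : FibrantReplacement C)

/-- H lifts the inverse of `rho`, up to unitors, through p_X; K extends H whiskered with the trivial
cofibration QX ⟶ RQX. -/
theorem exists_xi (X : C) : ∃ (H : WHomotopy (𝟙 (Q.obj X)) (Q.map (𝟙 X)))
    (K : WHomotopy (𝟙 (R.obj (Q.obj X))) (R.map (Q.map (𝟙 X)))),
    H.HasInvertibleCells ∧ K.HasInvertibleCells ∧
    Q.IsXi (HoCell.of.{w₁, v₁, u₁} (𝟙 (𝟙 X))) H.cls ∧ R.IsXi H.cls K.cls.{w₁, v₁, u₁} := by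
  obtain ⟨H, hH, eH⟩ := exists_wHomotopy_whiskerRight.{w₁, v₁, u₁} (Q.fib_p X) (Q.weq_p X)
    (λ_ (Q.p X) ≪≫ (ρ_ (Q.p X)).symm ≪≫ (Q.rho (𝟙 X)).symm)
  obtain ⟨K, hK, eK⟩ := exists_wHomotopy_whiskerLeft.{w₁, v₁, u₁} (R.cof_i (Q.obj X))
    (R.weq_i (Q.obj X)) (H.whiskerRight (R.i (Q.obj X))) (hH.whiskerRight _)
    (ρ_ (R.i (Q.obj X)) ≪≫ (λ_ (R.i (Q.obj X))).symm) (R.lam (Q.map (𝟙 X)))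
  -- The class of a whiskered homotopy is by definition the whiskered class, so `eK` is the required
  -- condition on K.
  refine ⟨H, K, hH, hK, ?_, eK⟩
  unfold CofibrantReplacement.IsXi
  rw [eH, HoCell.of_whiskerLeft, HoCell.of_comp, HoCell.of_comp]
  simp

/-- As for identities, with the pasting of the squares `rho` of f and g compared to the square of
the composite. -/
theorem exists_phi {X Y Z : C} (f : X ⟶ Y) (g : Y ⟶ Z) :
    ∃ (H : WHomotopy (Q.map f ≫ Q.map g) (Q.map (f ≫ g)))
      (K : WHomotopy (R.map (Q.map f) ≫ R.map (Q.map g)) (R.map (Q.map (f ≫ g)))),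
      H.HasInvertibleCells ∧ K.HasInvertibleCells ∧
      Q.IsPhi (HoCell.of.{w₁, v₁, u₁} (𝟙 (f ≫ g))) H.cls ∧ R.IsPhi H.cls K.cls.{w₁, v₁, u₁} := by
  obtain ⟨H, hH, eH⟩ := exists_wHomotopy_whiskerRight.{w₁, v₁, u₁} (Q.fib_p Z) (Q.weq_p Z)
    (squareComp (Q.rho f) (Q.rho g) ≪≫ (Q.rho (f ≫ g)).symm)
  obtain ⟨K, hK, eK⟩ := exists_wHomotopy_whiskerLeft.{w₁, v₁, u₁} (R.cof_i (Q.obj X))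
    (R.weq_i (Q.obj X)) (H.whiskerRight (R.i (Q.obj Z))) (hH.whiskerRight _)
    ((α_ _ _ _).symm ≪≫ whiskerRightIso (R.lam (Q.map f)).symm (R.map (Q.map g)) ≪≫
      α_ _ _ _ ≪≫ whiskerLeftIso (Q.map f) (R.lam (Q.map g)).symm ≪≫ (α_ _ _ _).symm)
    (R.lam (Q.map (f ≫ g)))
  refine ⟨H, K, hH, hK, ?_, eK⟩
  unfold CofibrantReplacement.IsPhi
  rw [eH, HoCell.of_whiskerLeft, HoCell.of_comp, HoCell.of_comp]
  simp

end StructuralHomotopies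

/-! ### The pseudofunctor RQ -/

section ReplacementPseudofunctor

variable {C : Type u} [Bicategory.{w, v} C] [ModelBicategory C]

namespace SigmaHo

/-- An arrow of `C` as an arrow of `Ho(C, W)`. -/
abbrev arr {X Y : C} (f : X ⟶ Y) : (SigmaHo.mk X : SigmaHo.{w₁, v₁, u₁} C) ⟶ SigmaHo.mk Y :=
  Hom.mk f

/-- A 2-cell of `Ho(C, W)`. -/
abbrev cell {X Y : C} {f g : X ⟶ Y} (a : HoCell.{w₁, v₁, u₁} f g) : arr f ⟶ arr g :=
  Hom₂.mk a

/-- The invertible 2-cell of `Ho(C, W)` given by a homotopy with invertible cells. -/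
noncomputable def isoOfHomotopy {X Y : C} {f g : X ⟶ Y} (H : WHomotopy f g)
    (hH : H.HasInvertibleCells) : arr.{w₁, v₁, u₁} f ≅ arr g where
  hom := cell H.cls
  inv := cell (ofHomotopy_invertible H.toSigma hH.1 hH.2).choose
  hom_inv_id := Hom₂.ext (ofHomotopy_invertible H.toSigma hH.1 hH.2).choose_spec.1
  inv_hom_id := Hom₂.ext (ofHomotopy_invertible H.toSigma hH.1 hH.2).choose_spec.2

theorem whiskerRight_injective {X Y Y' : C} {r : Y ⟶ Y'} (hr : weq r)
    {f g : (SigmaHo.mk X : SigmaHo.{w₁, v₁, u₁} C) ⟶ SigmaHo.mk Y} (a b : f ⟶ g)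
    (h : a ▷ arr r = b ▷ arr r) : a = b :=
  Hom₂.ext (HoCell.whiskerRight_injective hr (congrArg Hom₂.cell h))

theorem whiskerLeft_injective {X X' Y : C} {l : X' ⟶ X} (hl : weq l)
    {f g : (SigmaHo.mk X : SigmaHo.{w₁, v₁, u₁} C) ⟶ SigmaHo.mk Y} (a b : f ⟶ g)
    (h : arr l ◁ a = arr l ◁ b) : a = b :=
  Hom₂.ext (HoCell.whiskerLeft_injective hl (congrArg Hom₂.cell h))

/-- The image in `Ho(C, W)` of a square. -/
abbrev square {X X' Y Y' : C} {a : X ⟶ X'} {b : Y ⟶ Y'} {m : X ⟶ Y} {n : X' ⟶ Y'}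
    (s : m ≫ b ≅ a ≫ n) : arr.{w₁, v₁, u₁} m ≫ arr b ≅ arr a ≫ arr n :=
  isoMk s

/-- The bridge between equations of classes, in which `IsXi` and `IsPhi` are stated, and the
calculus of squares. -/
theorem compat_square_iff {X X' Y Y' : C} {a : X ⟶ X'} {b : Y ⟶ Y'} {m₁ m₂ : X ⟶ Y}
    {n₁ n₂ : X' ⟶ Y'} (s : m₁ ≫ b ≅ a ≫ n₁) (t : m₂ ≫ b ≅ a ≫ n₂)
    (κ : HoCell.{w₁, v₁, u₁} m₁ m₂) (τ : HoCell.{w₁, v₁, u₁} n₁ n₂) :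
    Compat (square s) (square t) (cell κ) (cell τ) ↔
      (κ.whiskerRight b).comp (HoCell.of t.hom) = (HoCell.of s.hom).comp (τ.whiskerLeft a) :=
  ⟨fun h => congrArg Hom₂.cell h, fun h => Hom₂.ext h⟩

theorem squareComp_square {X X' Y Y' Z Z' : C} {a : X ⟶ X'} {b : Y ⟶ Y'} {c : Z ⟶ Z'}
    {m : X ⟶ Y} {n : X' ⟶ Y'} {m' : Y ⟶ Z} {n' : Y' ⟶ Z'}
    (s : m ≫ b ≅ a ≫ n) (t : m' ≫ c ≅ b ≫ n') :
    squareComp (square.{w₁, v₁, u₁} s) (square t) = square (squareComp s t) := by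
  refine Iso.ext (Hom₂.ext ?_)
  change HoCell.comp (HoCell.of _) (HoCell.comp (HoCell.whiskerLeft _ (HoCell.of _))
    (HoCell.comp (HoCell.of _) (HoCell.comp (HoCell.whiskerRight (HoCell.of _) _)
      (HoCell.of _)))) = HoCell.of _
  rw [HoCell.of_whiskerLeft, HoCell.of_whiskerRight, HoCell.of_comp, HoCell.of_comp,
    HoCell.of_comp, HoCell.of_comp]
  rfl

theorem squareId_arr {X X' : C} (a : X ⟶ X') :
    squareId (arr.{w₁, v₁, u₁} a) = square (squareId a) := by
  refine Iso.ext (Hom₂.ext ?_)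
  exact HoCell.of_comp _ _

end SigmaHo

open SigmaHo

variable (Q : CofibrantReplacement C) (R : FibrantReplacement C)

/-- The w-homotopies that `Q` and `R` associate with identities and composites. -/
structure StructuralHomotopies where
  xiQ (X : C) : WHomotopy (𝟙 (Q.obj X)) (Q.map (𝟙 X))
  xiR (X : C) : WHomotopy (𝟙 (R.obj (Q.obj X))) (R.map (Q.map (𝟙 X)))
  phiQ {X Y Z : C} (f : X ⟶ Y) (g : Y ⟶ Z) : WHomotopy (Q.map f ≫ Q.map g) (Q.map (f ≫ g))
  phiR {X Y Z : C} (f : X ⟶ Y) (g : Y ⟶ Z) :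
    WHomotopy (R.map (Q.map f) ≫ R.map (Q.map g)) (R.map (Q.map (f ≫ g)))
  xiQ_inv (X : C) : (xiQ X).HasInvertibleCells
  xiR_inv (X : C) : (xiR X).HasInvertibleCells
  phiQ_inv {X Y Z : C} (f : X ⟶ Y) (g : Y ⟶ Z) : (phiQ f g).HasInvertibleCells
  phiR_inv {X Y Z : C} (f : X ⟶ Y) (g : Y ⟶ Z) : (phiR f g).HasInvertibleCells
  isXi_Q (X : C) : Q.IsXi (HoCell.of.{w₁, v₁, u₁} (𝟙 (𝟙 X))) (xiQ X).cls
  isXi_R (X : C) : R.IsXi (xiQ X).cls (xiR X).cls.{w₁, v₁, u₁}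
  isPhi_Q {X Y Z : C} (f : X ⟶ Y) (g : Y ⟶ Z) :
    Q.IsPhi (HoCell.of.{w₁, v₁, u₁} (𝟙 (f ≫ g))) (phiQ f g).cls
  isPhi_R {X Y Z : C} (f : X ⟶ Y) (g : Y ⟶ Z) :
    R.IsPhi (phiQ f g).cls (phiR f g).cls.{w₁, v₁, u₁}

theorem exists_structuralHomotopies : Nonempty (StructuralHomotopies.{w₁, v₁, u₁} Q R) := by
  choose H K hH hK eH eK using exists_xi.{w₁, v₁, u₁} Q R
  choose H' K' hH' hK' eH' eK' using
    fun {X Y Z : C} (f : X ⟶ Y) (g : Y ⟶ Z) => exists_phi.{w₁, v₁, u₁} Q R f g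
  exact ⟨⟨H, K, H', K', hH, hK, hH', hK', eH, eK, eH', eK'⟩⟩

namespace StructuralHomotopies

variable {Q R} (S : StructuralHomotopies.{w₁, v₁, u₁} Q R)

/-- `IsXi` with the inverse of `rho` moved to the other side: the homotopy on QX lies over an
identity 2-cell. -/
theorem compat_xiQ (X : C) : Compat (squareId (arr (Q.p X))) (square (Q.rho (𝟙 X)))
    (isoOfHomotopy.{w₁, v₁, u₁} (S.xiQ X) (S.xiQ_inv X)).hom (𝟙 (arr (𝟙 X))) := by
  rw [squareId_arr]
  refine (compat_square_iff _ _ _ _).2 ?_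
  rw [S.isXi_Q X, HoCell.assoc, HoCell.assoc, HoCell.of_comp, Iso.inv_hom_id, HoCell.comp_id]
  rfl

theorem compat_xiR (X : C) : Compat (squareId (arr (R.i (Q.obj X)))) (square (R.lam (Q.map (𝟙 X))))
    (isoOfHomotopy.{w₁, v₁, u₁} (S.xiQ X) (S.xiQ_inv X)).hom
    (isoOfHomotopy.{w₁, v₁, u₁} (S.xiR X) (S.xiR_inv X)).hom := by
  rw [squareId_arr]
  refine (compat_square_iff _ _ _ _).2 ?_
  rw [S.isXi_R X, ← HoCell.assoc (HoCell.of _), HoCell.of_comp]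
  simp [HoCell.id_comp]

theorem compat_phiQ {X Y Z : C} (f : X ⟶ Y) (g : Y ⟶ Z) :
    Compat (squareComp (square (Q.rho f)) (square (Q.rho g))) (square (Q.rho (f ≫ g)))
      (isoOfHomotopy.{w₁, v₁, u₁} (S.phiQ f g) (S.phiQ_inv f g)).hom (𝟙 (arr (f ≫ g))) := by
  rw [squareComp_square]
  refine (compat_square_iff _ _ _ _).2 ?_
  rw [S.isPhi_Q f g, HoCell.assoc, HoCell.assoc, HoCell.of_comp, Iso.inv_hom_id, HoCell.comp_id]
  rfl

theorem compat_phiR {X Y Z : C} (f : X ⟶ Y) (g : Y ⟶ Z) :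
    Compat (squareComp (square (R.lam (Q.map f))) (square (R.lam (Q.map g))))
      (square (R.lam (Q.map (f ≫ g))))
      (isoOfHomotopy.{w₁, v₁, u₁} (S.phiQ f g) (S.phiQ_inv f g)).hom
      (isoOfHomotopy.{w₁, v₁, u₁} (S.phiR f g) (S.phiR_inv f g)).hom := by
  rw [squareComp_square]
  refine (compat_square_iff _ _ _ _).2 ?_
  rw [S.isPhi_R f g, ← HoCell.assoc (HoCell.of _), HoCell.of_comp]
  simp [HoCell.id_comp]

-- The middle 2-cell is Qμ; the two conditions are the defining equations of Qμ and RQμ.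
variable (Q R) in
theorem compatSpan_map₂ {X Y : C} {f g : X ⟶ Y} (μ : f ⟶ g) :
    CompatSpan (square.{w₁, v₁, u₁} (Q.rho f)) (square (R.lam (Q.map f))) (square (Q.rho g))
      (square (R.lam (Q.map g))) (cell (HoCell.of μ))
      (cell (HoCell.of (R.map₂ (Q.map₂ μ)))) := by
  refine ⟨cell (HoCell.of (Q.map₂ μ)), (compat_square_iff _ _ _ _).2 ?_,
    (compat_square_iff _ _ _ _).2 ?_⟩
  · rw [HoCell.of_whiskerRight, HoCell.of_whiskerLeft, HoCell.of_comp, HoCell.of_comp, Q.map₂_p]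
    simp
  · rw [HoCell.of_whiskerRight, HoCell.of_whiskerLeft, HoCell.of_comp, HoCell.of_comp, R.i_map₂]
    simp

theorem compatSpan_xi_inv (X : C) :
    CompatSpan (square (Q.rho (𝟙 X))) (square (R.lam (Q.map (𝟙 X)))) (squareId (arr (Q.p X)))
      (squareId (arr (R.i (Q.obj X)))) (𝟙 (arr (𝟙 X)))
      (isoOfHomotopy.{w₁, v₁, u₁} (S.xiR X) (S.xiR_inv X)).inv :=
  compatSpan_inv (τ := Iso.refl _) (S.compat_xiQ X) (S.compat_xiR X)

/-- The middle 2-cell is the class of the homotopy given by Q. -/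
theorem compatSpan_phi {X Y Z : C} (f : X ⟶ Y) (g : Y ⟶ Z) :
    CompatSpan (squareComp (square (Q.rho f)) (square (Q.rho g)))
      (squareComp (square (R.lam (Q.map f))) (square (R.lam (Q.map g))))
      (square (Q.rho (f ≫ g))) (square (R.lam (Q.map (f ≫ g)))) (𝟙 (arr (f ≫ g)))
      (isoOfHomotopy.{w₁, v₁, u₁} (S.phiR f g) (S.phiR_inv f g)).hom :=
  ⟨_, S.compat_phiQ f g, S.compat_phiR f g⟩

theorem compatSpan_phi_inv {X Y Z : C} (f : X ⟶ Y) (g : Y ⟶ Z) :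
    CompatSpan (square (Q.rho (f ≫ g))) (square (R.lam (Q.map (f ≫ g))))
      (squareComp (square (Q.rho f)) (square (Q.rho g)))
      (squareComp (square (R.lam (Q.map f))) (square (R.lam (Q.map g)))) (𝟙 (arr (f ≫ g)))
      (isoOfHomotopy.{w₁, v₁, u₁} (S.phiR f g) (S.phiR_inv f g)).inv :=
  compatSpan_inv (τ := Iso.refl _) (S.compat_phiQ f g) (S.compat_phiR f g)

-- Faithfulness on the two sides comes from p_Y and from QX ⟶ RQX being weak equivalences.
variable (Q R) in
theorem compatSpan_unique {X Y : C} {m₁ m₂ : Q.obj X ⟶ Q.obj Y} {n₁ n₂ : X ⟶ Y}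
    {l₁ l₂ : R.obj (Q.obj X) ⟶ R.obj (Q.obj Y)}
    {s : arr.{w₁, v₁, u₁} m₁ ≫ arr (Q.p Y) ≅ arr (Q.p X) ≫ arr n₁}
    {s' : arr m₁ ≫ arr (R.i (Q.obj Y)) ≅ arr (R.i (Q.obj X)) ≫ arr l₁}
    {t : arr m₂ ≫ arr (Q.p Y) ≅ arr (Q.p X) ≫ arr n₂}
    {t' : arr m₂ ≫ arr (R.i (Q.obj Y)) ≅ arr (R.i (Q.obj X)) ≫ arr l₂} {τ τ' : arr n₁ ⟶ arr n₂}
    {υ υ' : arr l₁ ⟶ arr l₂} (h : CompatSpan s s' t t' τ υ) (h' : CompatSpan s s' t t' τ' υ')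
    (hτ : τ = τ') : υ = υ' :=
  h.unique h' (whiskerRight_injective (Q.weq_p Y)) (whiskerLeft_injective (R.weq_i (Q.obj X))) hτ

/-- The pseudofunctor `X ↦ RQX` with values in `Ho(C, W)`. -/
noncomputable def pseudofunctor : C ⥤ᵖ SigmaHo.{w₁, v₁, u₁} C where
  obj X := ⟨R.obj (Q.obj X)⟩
  map f := arr (R.map (Q.map f))
  map₂ μ := cell (HoCell.of (R.map₂ (Q.map₂ μ)))
  -- In every axiom both sides are exhibited over 2-cells of the base; the last argument is the
  -- equality of these.
  map₂_id f := compatSpan_unique Q R (compatSpan_map₂ Q R (𝟙 f)) (CompatSpan.refl _ _) rfl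
  map₂_comp μ ν := compatSpan_unique Q R (compatSpan_map₂ Q R (μ ≫ ν))
    ((compatSpan_map₂ Q R μ).trans (compatSpan_map₂ Q R ν)) (Hom₂.ext (HoCell.of_comp μ ν).symm)
  -- `mapId` and `mapComp` point away from the image of the identity and of the composite, so they
  -- are the inverses of ξ and φ.
  mapId X := (isoOfHomotopy (S.xiR X) (S.xiR_inv X)).symm
  mapComp f g := (isoOfHomotopy (S.phiR f g) (S.phiR_inv f g)).symm
  map₂_whisker_left f g h η := compatSpan_unique Q R (compatSpan_map₂ Q R (f ◁ η))
    ((S.compatSpan_phi_inv f g).trans (((compatSpan_map₂ Q R η).whiskerLeft _ _).trans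
      (S.compatSpan_phi f h))) (by
        erw [Category.id_comp, Category.comp_id]
        exact Hom₂.ext (HoCell.of_whiskerLeft f η).symm)
  map₂_whisker_right {_ _ _ f g} η h := compatSpan_unique Q R (compatSpan_map₂ Q R (η ▷ h))
    ((S.compatSpan_phi_inv f h).trans (((compatSpan_map₂ Q R η).whiskerRight _ _).trans
      (S.compatSpan_phi g h))) (by
        erw [Category.id_comp, Category.comp_id]
        exact Hom₂.ext (HoCell.of_whiskerRight η h).symm)
  -- Each structural 2-cell lies over an identity, so in the base only the associator of f, g, h
  -- remains.
  map₂_associator f g h := compatSpan_unique Q R (compatSpan_map₂ Q R (α_ f g h).hom)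
    ((S.compatSpan_phi_inv (f ≫ g) h).trans (((S.compatSpan_phi_inv f g).whiskerRight _ _).trans
      ((CompatSpan.associator _ _ _ _ _ _).trans (((S.compatSpan_phi g h).whiskerLeft _ _).trans
        (S.compatSpan_phi f (g ≫ h)))))) (by
        erw [Category.id_comp, Category.comp_id, Bicategory.id_whiskerRight, Category.id_comp,
          Bicategory.whiskerLeft_id, Category.comp_id]
        rfl)
  map₂_left_unitor {X _} f := compatSpan_unique Q R (compatSpan_map₂ Q R (λ_ f).hom)
    ((S.compatSpan_phi_inv (𝟙 X) f).trans (((S.compatSpan_xi_inv X).whiskerRight _ _).trans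
      (CompatSpan.leftUnitor _ _))) (by
        erw [Category.id_comp, Bicategory.id_whiskerRight, Category.id_comp]
        rfl)
  map₂_right_unitor {_ Y} f := compatSpan_unique Q R (compatSpan_map₂ Q R (ρ_ f).hom)
    ((S.compatSpan_phi_inv f (𝟙 Y)).trans (((S.compatSpan_xi_inv Y).whiskerLeft _ _).trans
      (CompatSpan.rightUnitor _ _))) (by
        erw [Category.id_comp, Bicategory.whiskerLeft_id, Category.id_comp]
        rfl)

/-- The pseudofunctor `X ↦ RQX` with values in `Ho(C)`. -/
noncomputable def pseudofunctorHo : C ⥤ᵖ Ho.{w₁, v₁, u₁} C where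
  -- The prescribed data are used literally, so that the agreement with them holds by reflexivity;
  -- the axioms are inherited from Ho(C, W), the sub-bicategory being full.
  toPrelaxFunctorStruct := replacementCells.{w₁, v₁, u₁} Q R
  map₂_id f := InducedBicategory.hom₂_ext (S.pseudofunctor.map₂_id f)
  map₂_comp μ ν := InducedBicategory.hom₂_ext (S.pseudofunctor.map₂_comp μ ν)
  mapId X := InducedBicategory.isoMk (S.pseudofunctor.mapId X)
  mapComp f g := InducedBicategory.isoMk (S.pseudofunctor.mapComp f g)
  map₂_whisker_left f _ _ η := InducedBicategory.hom₂_ext (S.pseudofunctor.map₂_whisker_left f η)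
  map₂_whisker_right η h := InducedBicategory.hom₂_ext (S.pseudofunctor.map₂_whisker_right η h)
  map₂_associator f g h := InducedBicategory.hom₂_ext (S.pseudofunctor.map₂_associator f g h)
  map₂_left_unitor f := InducedBicategory.hom₂_ext (S.pseudofunctor.map₂_left_unitor f)
  map₂_right_unitor f := InducedBicategory.hom₂_ext (S.pseudofunctor.map₂_right_unitor f)

end StructuralHomotopies

end ReplacementPseudofunctor

end ModelBicat

/-- In every model bicategory `C` (normalized) cofibrant and fibrant replacements `Q`, `R` exist,
and for all of them there is a pseudofunctor `r : C ⥤ Ho(C)` given by `X ↦ RQX`, `f ↦ RQf`,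
`μ ↦ i(RQμ)`, whose structural 2-cells `ξ_X : id ⇒ r(id_X)` and `φ_{f,g} : rg * rf ⇒ r(g * f)` are
classes of w-homotopies with invertible cells, obtained by applying first `Q` and then `R` to the
identity 2-cells of `id_X` and of `g * f`. -/
theorem proposition4p5 (C : Type u) [Bicategory.{w, v} C] [ModelBicat.ModelBicategory C] :
    (∃ (Q : ModelBicat.CofibrantReplacement C) (R : ModelBicat.FibrantReplacement C),
      Q.IsNormalized ∧ R.IsNormalized) ∧
    ∀ (Q : ModelBicat.CofibrantReplacement C) (R : ModelBicat.FibrantReplacement C),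
      ∃ r : C ⥤ᵖ ModelBicat.Ho.{w₁, v₁, u₁} C,
        r.toPrelaxFunctorStruct = ModelBicat.replacementCells.{w₁, v₁, u₁} Q R ∧
        (∀ X : C,
          ∃ (H : ModelBicat.WHomotopy (𝟙 (Q.obj X)) (Q.map (𝟙 X)))
            (K : ModelBicat.WHomotopy (𝟙 (R.obj (Q.obj X))) (R.map (Q.map (𝟙 X)))),
            H.HasInvertibleCells ∧ K.HasInvertibleCells ∧
            Q.IsXi (ModelBicat.HoCell.of.{w₁, v₁, u₁} (𝟙 (𝟙 X))) H.cls ∧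
            R.IsXi H.cls K.cls.{w₁, v₁, u₁} ∧
            (r.mapId X).inv ≍ ModelBicat.Ho.cellMk.{w₁, v₁, u₁}
              (X := ModelBicat.replacementObj Q R X) (Y := ModelBicat.replacementObj Q R X) K.cls) ∧
        (∀ {X Y Z : C} (f : X ⟶ Y) (g : Y ⟶ Z),
          ∃ (H : ModelBicat.WHomotopy (Q.map f ≫ Q.map g) (Q.map (f ≫ g)))
            (K : ModelBicat.WHomotopy (R.map (Q.map f) ≫ R.map (Q.map g)) (R.map (Q.map (f ≫ g)))),
            H.HasInvertibleCells ∧ K.HasInvertibleCells ∧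
            Q.IsPhi (ModelBicat.HoCell.of.{w₁, v₁, u₁} (𝟙 (f ≫ g))) H.cls ∧
            R.IsPhi H.cls K.cls.{w₁, v₁, u₁} ∧
            (r.mapComp f g).inv ≍ ModelBicat.Ho.cellMk.{w₁, v₁, u₁}
              (X := ModelBicat.replacementObj Q R X) (Y := ModelBicat.replacementObj Q R Z) K.cls) :=
  by
  refine ⟨?_, fun Q R => ?_⟩
  · obtain ⟨Q, hQ⟩ := ModelBicat.exists_cofibrantReplacement C
    obtain ⟨R, hR⟩ := ModelBicat.exists_fibrantReplacement C
    exact ⟨Q, R, hQ, hR⟩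
  · obtain ⟨S⟩ := ModelBicat.exists_structuralHomotopies.{w₁, v₁, u₁} Q R
    -- The inverses of `mapId` and `mapComp` are by construction the classes of the chosen
    -- homotopies, hence the reflexivity proofs.
    exact ⟨S.pseudofunctorHo, rfl,
      fun X => ⟨S.xiQ X, S.xiR X, S.xiQ_inv X, S.xiR_inv X, S.isXi_Q X, S.isXi_R X, HEq.rfl⟩,
      fun f g => ⟨S.phiQ f g, S.phiR f g, S.phiQ_inv f g, S.phiR_inv f g, S.isPhi_Q f g,
        S.isPhi_R f g, HEq.rfl⟩⟩
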